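/- Let $\Omega\subset\mathbb R^2$ be a bounded open set with smooth boundary, and let $G_\Omega$ be its Green's function with zero Dirichlet boundary conditions, $G_\Omega(x,y)=\frac1{2\pi}\log|x-y|^{-1}+g_\Omega(x,y)$, where for each $y\in\Omega$ the function $x\mapsto g_\Omega(x,y)$ is harmonic in $\Omega$, continuous on $\overline\Omega$ and equal to $-\frac1{2\pi}\log|x-y|^{-1}$ for $x\in\partial\Omega$, and $g_\Omega(x,y)=g_\Omega(y,x)$ for $x,y\in\Omega$. For $\alpha_1,\dots,\alpha_n\in\mathbb R$ write $\|\alpha\|=\max_{1\le i\le n}|\alpha_i|$, and for $A\subset\mathbb R^2$ and a function $f$ on $A$ write $$\|f\|_{\mathrm{Lip}(A)}=\sup_{x\in A}|f(x)|+\sup_{x,y\in A,\ x\ne y}\frac{|f(x)-f(y)|}{|x-y|}.$$ For $n\ge 2$, $\alpha_1,\dots,\alpha_n\in(-\sqrt{4\pi},\sqrt{4\pi})$ and $f_2,\dots,f_n\in C_c^\infty(\Omega)$ (possibly complex valued), let $$G_n(x_1)=\int_{\Omega^{n-1}}d^2x_2\cdots d^2x_n\ \prod_{j=2}^n f_j(x_j)\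 \exp\Big(-\sum_{1\le k<l\le n}\alpha_k\alpha_l\,G_\Omega(x_k,x_l)\Big),\qquad x_1\in\Omega.$$ Then this integral converges absolutely for every $x_1\in\Omega$; for each compact $K\subset\Omega$ the function $G_n$ is Lipschitz continuous on $K$; and there is a constant $C>0$ depending only on $K$, $\Omega$, $\|\alpha\|$, $\bigcup_{i=2}^n\mathrm{supp}(f_i)$ and $\max_{2\le i\le n}\|f_i\|_{\mathrm{Lip}(\Omega)}$ (in particular, not otherwise on $n$, the $\alpha_i$ or the $f_i$) such that $$\|G_n\|_{\mathrm{Lip}(K)}\le C^n\, n^{\frac{\|\alpha\|^2}{8\pi}n}.$$ -/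

import Mathlib

open MeasureTheory Topology InnerProductSpace
open scoped ContDiff

/-! Throughout, the plane is `ℂ`, with its Euclidean norm and Lebesgue measure. -/

/-- `Ω` is a bounded open subset of the plane with smooth boundary: near each boundary point it is
the sublevel set of a smooth function whose differential does not vanish at that point. -/
structure IsSmoothBoundedOpen (Ω : Set ℂ) : Prop where
  isOpen : IsOpen Ω
  isBounded : Bornology.IsBounded Ω
  smooth_boundary : ∀ p ∈ frontier Ω, ∃ U ∈ 𝓝 p, ∃ ρ : ℂ → ℝ,
    ContDiff ℝ ∞ ρ ∧ fderiv ℝ ρ p ≠ 0 ∧ ∀ x ∈ U, x ∈ Ω ↔ ρ x < 0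

/-- `g` is the regular part `g_Ω` of the Dirichlet Green's function of `Ω`: for every `y ∈ Ω` the
function `x ↦ g x y` is continuous on the closure of `Ω`, harmonic in `Ω`, and equal to
`-(1/2π) log |x - y|⁻¹` on `∂Ω`; and `g` is symmetric on `Ω × Ω`. -/
structure IsGreenRegularPart (Ω : Set ℂ) (g : ℂ → ℂ → ℝ) : Prop where
  continuousOn : ∀ y ∈ Ω, ContinuousOn (fun x => g x y) (closure Ω)
  harmonic : ∀ y ∈ Ω, HarmonicOnNhd (fun x => g x y) Ω
  boundary : ∀ y ∈ Ω, ∀ x ∈ frontier Ω,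
    g x y = -(1 / (2 * Real.pi) * Real.log ‖x - y‖⁻¹)
  symm : ∀ x ∈ Ω, ∀ y ∈ Ω, g x y = g y x

/-- Maximum principle: a harmonic function on a bounded open set that is continuous up to the
boundary and vanishes there is nonpositive. -/
theorem harmonic_nonpos_of_frontier {Ω : Set ℂ} (ho : IsOpen Ω) (hb : Bornology.IsBounded Ω)
    {u : ℂ → ℝ} (hc : ContinuousOn u (closure Ω)) (hh : HarmonicOnNhd u Ω)
    (h0 : ∀ x ∈ frontier Ω, u x = 0) : ∀ x ∈ closure Ω, u x ≤ 0 := by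
  intro x hx
  by_contra! hpos
  have hcomp : IsCompact (closure Ω) := hb.isCompact_closure
  obtain ⟨p, hp, hpmax⟩ := hcomp.exists_isMaxOn ⟨x, hx⟩ hc
  set M := u p with hM
  have hMpos : 0 < M := lt_of_lt_of_le hpos (hpmax hx)
  have hSc : IsCompact (closure Ω ∩ u ⁻¹' {M}) :=
    hcomp.of_isClosed_subset (hc.preimage_isClosed_of_isClosed isClosed_closure isClosed_singleton)
      Set.inter_subset_left
  obtain ⟨q, ⟨hq, hqM⟩, hqmax⟩ :=
    hSc.exists_isMaxOn ⟨p, hp, rfl⟩ Complex.continuous_re.continuousOn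
  have hqM' : u q = M := hqM
  have hqΩ : q ∈ Ω := by
    by_contra hn
    have : q ∈ frontier Ω := by
      rw [ho.frontier_eq]; exact ⟨hq, hn⟩
    have := h0 q this
    linarith
  obtain ⟨r, hr, hrΩ⟩ := Metric.isOpen_iff.1 ho q hqΩ
  obtain ⟨F, hF, hFu⟩ := (hh.mono hrΩ).exists_analyticOnNhd_ball_re_eq
  have hev : ∀ᶠ z in 𝓝 q, z ∈ Metric.ball q r := Metric.ball_mem_nhds q hr
  have hdiff : ∀ᶠ z in 𝓝 q, DifferentiableAt ℂ (fun z => Complex.exp (F z)) z := by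
    filter_upwards [hev] with z hz
    exact (hF z hz).differentiableAt.cexp
  have hnorm : ∀ z ∈ Metric.ball q r, ‖Complex.exp (F z)‖ = Real.exp (u z) := by
    intro z hz
    rw [Complex.norm_exp]
    congr 1
    exact hFu hz
  have hloc : IsLocalMax (norm ∘ fun z => Complex.exp (F z)) q := by
    filter_upwards [hev] with z hz
    simp only [Function.comp]
    rw [hnorm z hz, hnorm q (Metric.mem_ball_self hr), Real.exp_le_exp, hqM']
    exact hpmax (subset_closure (hrΩ hz))
  have hconst := Complex.eventually_eq_of_isLocalMax_norm hdiff hloc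
  have hconst' : ∀ᶠ z in 𝓝 q, z ∈ Metric.ball q r ∧ u z = M := by
    filter_upwards [hev, hconst] with z hz hz'
    refine ⟨hz, ?_⟩
    have h1 := hnorm z hz
    rw [hz', hnorm q (Metric.mem_ball_self hr), hqM'] at h1
    exact (Real.exp_injective h1).symm
  obtain ⟨s, hs, hsub⟩ := Metric.eventually_nhds_iff_ball.1 hconst'
  have hmem : q + ((s / 2 : ℝ) : ℂ) ∈ Metric.ball q s := by
    rw [Metric.mem_ball, dist_eq_norm, add_sub_cancel_left, Complex.norm_real,
      Real.norm_of_nonneg (by positivity)]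
    linarith
  obtain ⟨hz1, hz2⟩ := hsub _ hmem
  have hle : (q + ((s / 2 : ℝ) : ℂ)).re ≤ q.re :=
    hqmax (show q + ((s / 2 : ℝ) : ℂ) ∈ closure Ω ∩ u ⁻¹' {M} from
      ⟨subset_closure (hrΩ hz1), hz2⟩)
  rw [Complex.add_re, Complex.ofReal_re] at hle
  linarith

/-- The regular part of the Green's function is uniquely determined. -/
theorem IsGreenRegularPart.unique {Ω : Set ℂ} (ho : IsOpen Ω) (hb : Bornology.IsBounded Ω)
    {g h : ℂ → ℂ → ℝ} (hg : IsGreenRegularPart Ω g) (hh : IsGreenRegularPart Ω h) :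
    ∀ x ∈ closure Ω, ∀ y ∈ Ω, g x y = h x y := by
  have key : ∀ {g h : ℂ → ℂ → ℝ}, IsGreenRegularPart Ω g → IsGreenRegularPart Ω h →
      ∀ x ∈ closure Ω, ∀ y ∈ Ω, g x y ≤ h x y := by
    intro g h hg hh x hx y hy
    have := harmonic_nonpos_of_frontier ho hb
      (u := (fun x => g x y) - (fun x => h x y))
      ((hg.continuousOn y hy).sub (hh.continuousOn y hy))
      ((hg.harmonic y hy).sub (hh.harmonic y hy))
      (fun z hz => by simp [hg.boundary y hy z hz, hh.boundary y hy z hz]) x hx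
    simpa using this
  exact fun x hx y hy => le_antisymm (key hg hh x hx y hy) (key hh hg x hx y hy)

open Classical in
/-- The Green's function `G_Ω(x, y) = (1/2π) log |x - y|⁻¹ + g_Ω(x, y)` of `Ω` with zero Dirichlet
boundary conditions, for `x, y ∈ Ω`. The regular part `g_Ω` is unique, and it exists for a bounded
open set with smooth boundary; for a set without Green's function the value is `0`. -/
noncomputable def greenFunction (Ω : Set ℂ) (x y : ℂ) : ℝ :=
  if h : ∃ g, IsGreenRegularPart Ω g then
    1 / (2 * Real.pi) * Real.log ‖x - y‖⁻¹ + h.choose x y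
  else 0

/-- The Green's function is computed by any function with the properties of the regular part. -/
theorem greenFunction_eq {Ω : Set ℂ} (ho : IsOpen Ω) (hb : Bornology.IsBounded Ω)
    {g : ℂ → ℂ → ℝ} (hg : IsGreenRegularPart Ω g) {x y : ℂ} (hx : x ∈ Ω) (hy : y ∈ Ω) :
    greenFunction Ω x y = 1 / (2 * Real.pi) * Real.log ‖x - y‖⁻¹ + g x y := by
  have h : ∃ g, IsGreenRegularPart Ω g := ⟨g, hg⟩
  rw [greenFunction, dif_pos h,
    h.choose_spec.unique ho hb hg x (subset_closure hx) y hy]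

/-- The Lipschitz norm `sup_A |f| + sup_{x ≠ y in A} |f x - f y| / |x - y|`, as an extended
nonnegative number (`∞` if one of the suprema is infinite). -/
noncomputable def lipNorm (A : Set ℂ) (f : ℂ → ℂ) : ENNReal :=
  (⨆ x ∈ A, ‖f x‖ₑ) + ⨆ x ∈ A, ⨆ y ∈ A, ⨆ _ : x ≠ y, ‖f x - f y‖ₑ / ‖x - y‖ₑ

/-- `‖α‖ = max_i |α_i|`. -/
noncomputable def chargeNorm {n : ℕ} (α : Fin n → ℝ) : ℝ := ⨆ i, |α i|

/-- The interaction energy `∑_{k < l} α_k α_l G_Ω(x_k, x_l)`. -/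
noncomputable def coulombEnergy (Ω : Set ℂ) {n : ℕ} (α : Fin n → ℝ) (x : Fin n → ℂ) : ℝ :=
  ∑ k, ∑ l ∈ Finset.Ioi k, α k * α l * greenFunction Ω (x k) (x l)

/-- The integrand of `G_n(x₁)` with `n = m + 1`, as a function of the other points
`x = (x_2, …, x_n)`; the functions `f = (f_2, …, f_n)` are indexed by `Fin m` in the same order. -/
noncomputable def onePointIntegrand (Ω : Set ℂ) {m : ℕ} (α : Fin (m + 1) → ℝ)
    (f : Fin m → ℂ → ℂ) (x₁ : ℂ) (x : Fin m → ℂ) : ℂ :=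
  (∏ j, f j (x j)) *
    (Real.exp (-coulombEnergy Ω α (Fin.cons x₁ x : Fin (m + 1) → ℂ)) : ℂ)

/-- The function `G_n` with `n = m + 1`: the integral over `Ω^{n-1}` of the integrand above. -/
noncomputable def onePointIntegral (Ω : Set ℂ) {m : ℕ} (α : Fin (m + 1) → ℝ)
    (f : Fin m → ℂ → ℂ) (x₁ : ℂ) : ℂ :=
  ∫ x in Set.univ.pi (fun _ : Fin m => Ω), onePointIntegrand Ω α f x₁ x

/-!
Onsager's inequality drives the bound. Smear each charge over a disc whose radius `r_k` is half the
distance to the nearest other charge. Since the discs are disjoint, the mean value property shows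
that smearing does not change the interaction of distinct charges; since the Dirichlet energy of the
total potential is nonnegative, the interaction energy is at least minus the sum of the
self-energies, and `exp (-E) ≤ Aⁿ ∏ r_k ^ (-a)` with `a = ‖α‖² / 4π < 1`. Now integrate the points
out one at a time. A new point becomes the nearest neighbour of boundedly many old ones only, so its
integral is at most a sum over the old points of a singularity of exponent `2 a < 2`; cutting the
singularities off at the scale `n ^ (-1/2)` and packing the remaining discs bounds it by
`O(n ^ (a / 2))`.

For the Lipschitz bound, translate the integration variables along with `x₁`. The logarithms do not
notice, so only `g_Ω` and the `f_j` vary, which costs a factor `O(n²)` times the displacement.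
-/

theorem harmonic_le_of_frontier {Ω : Set ℂ} (ho : IsOpen Ω) (hb : Bornology.IsBounded Ω)
    {u : ℂ → ℝ} {B : ℝ} (hc : ContinuousOn u (closure Ω)) (hh : HarmonicOnNhd u Ω)
    (hB : ∀ x ∈ frontier Ω, u x ≤ B) {x : ℂ} (hx : x ∈ closure Ω) : u x ≤ B := by
  by_contra! hlt
  set V : Set ℂ := Ω ∩ u ⁻¹' Set.Ioi B
  have hVo : IsOpen V := (hc.mono subset_closure).isOpen_inter_preimage ho isOpen_Ioi
  have hVcl : closure V ⊆ closure Ω := closure_mono Set.inter_subset_left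
  have hxV : x ∈ V := by
    refine ⟨by_contra fun hn => (hB x ?_).not_gt hlt, hlt⟩
    rw [ho.frontier_eq]
    exact ⟨hx, hn⟩
  have hVfr : ∀ z ∈ frontier V, u z - B = 0 := by
    intro z hz
    rw [hVo.frontier_eq] at hz
    have hVge : V ⊆ closure Ω ∩ u ⁻¹' Set.Ici B :=
      Set.inter_subset_inter subset_closure (Set.preimage_mono Set.Ioi_subset_Ici_self)
    have hge : B ≤ u z := (closure_minimal hVge
      (hc.preimage_isClosed_of_isClosed isClosed_closure isClosed_Ici) hz.1).2
    have hle : u z ≤ B := by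
      by_cases hzΩ : z ∈ Ω
      · exact not_lt.1 fun h => hz.2 ⟨hzΩ, h⟩
      · refine hB z ?_
        rw [ho.frontier_eq]
        exact ⟨hVcl hz.1, hzΩ⟩
    linarith
  have hle : u x - B ≤ 0 := harmonic_nonpos_of_frontier hVo (hb.subset Set.inter_subset_left)
    ((hc.mono hVcl).sub continuousOn_const)
    ((hh.mono Set.inter_subset_left).sub (harmonicOnNhd_const B)) hVfr x (subset_closure hxV)
  linarith

theorem abs_sub_le_exp_mul_abs_exp_sub_exp {B s t : ℝ} (hs : -B ≤ s) (ht : -B ≤ t) :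
    |s - t| ≤ Real.exp B * |Real.exp s - Real.exp t| := by
  wlog hts : t ≤ s generalizing s t
  · rw [abs_sub_comm, abs_sub_comm (Real.exp s)]
    exact this ht hs (le_of_not_ge hts)
  have hexp : 0 ≤ Real.exp s - Real.exp t := sub_nonneg.2 (Real.exp_le_exp.2 hts)
  rw [abs_of_nonneg (sub_nonneg.2 hts), abs_of_nonneg hexp]
  calc s - t ≤ Real.exp (s - t) - 1 := by linarith [Real.add_one_le_exp (s - t)]
    _ = Real.exp (-t) * (Real.exp s - Real.exp t) := by
        rw [mul_sub, ← Real.exp_add, ← Real.exp_add, neg_add_cancel, Real.exp_zero,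
          neg_add_eq_sub]
    _ ≤ Real.exp B * (Real.exp s - Real.exp t) :=
        mul_le_mul_of_nonneg_right (Real.exp_le_exp.2 (by linarith)) hexp

theorem abs_sub_center_le_of_harmonicOnNhd_ball {h : ℂ → ℝ} {c : ℂ} {δ B : ℝ} (hδ : 0 < δ)
    (hh : HarmonicOnNhd h (Metric.ball c δ)) (hB : ∀ x ∈ Metric.ball c δ, |h x| ≤ B)
    {x : ℂ} (hx : x ∈ Metric.ball c δ) :
    |h x - h c| ≤ 3 * Real.exp (2 * B) / δ * ‖x - c‖ := by
  obtain ⟨F, hF, hFh⟩ := hh.exists_analyticOnNhd_ball_re_eq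
  have hc : c ∈ Metric.ball c δ := Metric.mem_ball_self hδ
  have hnorm : ∀ z ∈ Metric.ball c δ, ‖Complex.exp (F z)‖ = Real.exp (h z) := fun z hz => by
    rw [Complex.norm_exp, ← hFh hz]
  have hnorm_le : ∀ z ∈ Metric.ball c δ, ‖Complex.exp (F z)‖ ≤ Real.exp B := fun z hz =>
    hnorm z hz ▸ Real.exp_le_exp.2 (abs_le.1 (hB z hz)).2
  have hmaps : Set.MapsTo (fun z => Complex.exp (F z)) (Metric.ball c δ)
      (Metric.closedBall (Complex.exp (F c)) (3 * Real.exp B)) := fun z hz => by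
    rw [Metric.mem_closedBall, dist_eq_norm]
    linarith [norm_sub_le (Complex.exp (F z)) (Complex.exp (F c)), hnorm_le z hz,
      hnorm_le c hc, Real.exp_pos B]
  have hdiff : DifferentiableOn ℂ (fun z => Complex.exp (F z)) (Metric.ball c δ) :=
    fun z hz => (hF z hz).differentiableAt.cexp.differentiableWithinAt
  have hschwarz : |Real.exp (h x) - Real.exp (h c)| ≤ 3 * Real.exp B / δ * ‖x - c‖ := by
    rw [← hnorm x hx, ← hnorm c hc, ← dist_eq_norm x c]
    refine (abs_norm_sub_norm_le _ _).trans ?_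
    rw [← dist_eq_norm]
    exact Complex.dist_le_div_mul_dist_of_mapsTo_ball hdiff hmaps hx
  calc |h x - h c| ≤ Real.exp B * |Real.exp (h x) - Real.exp (h c)| :=
        abs_sub_le_exp_mul_abs_exp_sub_exp (abs_le.1 (hB x hx)).1 (abs_le.1 (hB c hc)).1
    _ ≤ Real.exp B * (3 * Real.exp B / δ * ‖x - c‖) := by gcongr
    _ = 3 * Real.exp (2 * B) / δ * ‖x - c‖ := by rw [two_mul, Real.exp_add]; ring

theorem closedBall_subset_of_norm_sub_lt {E : Type*} [SeminormedAddCommGroup E] {s : Set E}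
    {x y : E} {δ : ℝ} (hx : Metric.closedBall x (2 * δ) ⊆ s) (hxy : ‖y - x‖ < δ) :
    Metric.closedBall y δ ⊆ s :=
  (Metric.closedBall_subset_closedBall' (by rw [dist_eq_norm]; linarith)).trans hx

namespace IsGreenRegularPart

variable {Ω : Set ℂ} {g : ℂ → ℂ → ℝ}

theorem le_log_diam (hg : IsGreenRegularPart Ω g) (ho : IsOpen Ω) (hb : Bornology.IsBounded Ω)
    {x y : ℂ} (hx : x ∈ closure Ω) (hy : y ∈ Ω) :
    g x y ≤ 1 / (2 * Real.pi) * Real.log (Metric.diam (closure Ω)) := by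
  refine harmonic_le_of_frontier ho hb (hg.continuousOn y hy) (hg.harmonic y hy) ?_ hx
  intro z hz
  have hzΩ : z ∈ closure Ω \ Ω := ho.frontier_eq ▸ hz
  have hzy : z ≠ y := fun h => hzΩ.2 (h ▸ hy)
  have hdist : ‖z - y‖ ≤ Metric.diam (closure Ω) := by
    rw [← dist_eq_norm]
    exact Metric.dist_le_diam_of_mem hb.closure hzΩ.1 (subset_closure hy)
  rw [hg.boundary y hy z hz, Real.log_inv, mul_neg, neg_neg]
  gcongr
  exact norm_pos_iff.2 (sub_ne_zero.2 hzy)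

theorem log_radius_le (hg : IsGreenRegularPart Ω g) (ho : IsOpen Ω) (hb : Bornology.IsBounded Ω)
    {δ : ℝ} (hδ : 0 < δ) {x y : ℂ} (hx : x ∈ closure Ω) (hy : Metric.closedBall y δ ⊆ Ω) :
    1 / (2 * Real.pi) * Real.log δ ≤ g x y := by
  have hyΩ : y ∈ Ω := hy (Metric.mem_closedBall_self hδ.le)
  refine neg_le_neg_iff.1 (harmonic_le_of_frontier (u := -fun x => g x y) ho hb
    (hg.continuousOn y hyΩ).neg (hg.harmonic y hyΩ).neg (fun z hz => ?_) hx)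
  have hzy : δ ≤ ‖z - y‖ := by
    have hz' : z ∈ closure Ω \ Ω := ho.frontier_eq ▸ hz
    by_contra! h
    exact hz'.2 (hy (mem_closedBall_iff_norm.2 h.le))
  rw [Pi.neg_apply, neg_le_neg_iff, hg.boundary y hyΩ z hz, Real.log_inv, mul_neg, neg_neg]
  gcongr

theorem exists_abs_le (hg : IsGreenRegularPart Ω g) (ho : IsOpen Ω) (hb : Bornology.IsBounded Ω)
    {δ : ℝ} (hδ : 0 < δ) :
    ∃ B : ℝ, ∀ x ∈ closure Ω, ∀ y, Metric.closedBall y δ ⊆ Ω → |g x y| ≤ B := by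
  refine ⟨max (1 / (2 * Real.pi) * Real.log (Metric.diam (closure Ω)))
    (-(1 / (2 * Real.pi) * Real.log δ)), fun x hx y hy => abs_le'.2 ⟨?_, ?_⟩⟩
  · exact (hg.le_log_diam ho hb hx (hy (Metric.mem_closedBall_self hδ.le))).trans
      (le_max_left _ _)
  · exact (neg_le_neg (hg.log_radius_le ho hb hδ hx hy)).trans (le_max_right _ _)

theorem exists_abs_sub_le (hg : IsGreenRegularPart Ω g) (ho : IsOpen Ω)
    (hb : Bornology.IsBounded Ω) {δ : ℝ} (hδ : 0 < δ) :
    ∃ L : ℝ, 0 ≤ L ∧ ∀ x y x' y' : ℂ, Metric.closedBall x (2 * δ) ⊆ Ω →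
      Metric.closedBall y (2 * δ) ⊆ Ω → ‖x' - x‖ < δ → ‖y' - y‖ < δ →
      |g x' y' - g x y| ≤ L * (‖x' - x‖ + ‖y' - y‖) := by
  obtain ⟨B, hB⟩ := hg.exists_abs_le ho hb hδ
  have hmem : ∀ {z}, Metric.closedBall z δ ⊆ Ω → z ∈ Ω :=
    fun h => h (Metric.mem_closedBall_self hδ.le)
  have hfirst : ∀ x x' y, Metric.closedBall x (2 * δ) ⊆ Ω → Metric.closedBall y δ ⊆ Ω →
      ‖x' - x‖ < δ → |g x' y - g x y| ≤ 3 * Real.exp (2 * B) / δ * ‖x' - x‖ := by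
    intro x x' y hx hy hxx
    have hsub : Metric.ball x δ ⊆ Ω :=
      (Metric.ball_subset_closedBall.trans
        (Metric.closedBall_subset_closedBall (by linarith))).trans hx
    exact abs_sub_center_le_of_harmonicOnNhd_ball hδ ((hg.harmonic y (hmem hy)).mono hsub)
      (fun z hz => hB z (subset_closure (hsub hz)) y hy) (mem_ball_iff_norm.2 hxx)
  refine ⟨3 * Real.exp (2 * B) / δ, by positivity, fun x y x' y' hx hy hxx hyy => ?_⟩
  have hx₀ := closedBall_subset_of_norm_sub_lt hx (y := x) (by simpa)
  have hy₀ := closedBall_subset_of_norm_sub_lt hy (y := y) (by simpa)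
  have hy' := closedBall_subset_of_norm_sub_lt hy hyy
  have hsecond := hfirst y y' x hy hx₀ hyy
  rw [hg.symm y' (hmem hy') x (hmem hx₀), hg.symm y (hmem hy₀) x (hmem hx₀)] at hsecond
  linarith [hfirst x x' y' hx hy' hxx, abs_sub_le (g x' y') (g x y') (g x y)]

theorem continuousOn_uncurry (hg : IsGreenRegularPart Ω g) (ho : IsOpen Ω)
    (hb : Bornology.IsBounded Ω) : ContinuousOn (Function.uncurry g) (Ω ×ˢ Ω) := by
  rintro ⟨x, y⟩ ⟨hx, hy⟩
  obtain ⟨r, hr, hrx⟩ := Metric.nhds_basis_closedBall.mem_iff.1 (ho.mem_nhds hx)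
  obtain ⟨s, hs, hsy⟩ := Metric.nhds_basis_closedBall.mem_iff.1 (ho.mem_nhds hy)
  have hδ : 0 < min r s / 2 := by positivity
  obtain ⟨L, -, hLip⟩ := hg.exists_abs_sub_le ho hb hδ
  have hsmall : Filter.Tendsto (fun p : ℂ × ℂ => L * (‖p.1 - x‖ + ‖p.2 - y‖)) (𝓝 (x, y)) (𝓝 0) :=
    Continuous.tendsto' (by fun_prop) _ _ (by simp)
  refine ContinuousAt.continuousWithinAt (tendsto_iff_dist_tendsto_zero.2
    (squeeze_zero' (Filter.Eventually.of_forall fun _ => dist_nonneg) ?_ hsmall))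
  filter_upwards [Metric.ball_mem_nhds (x, y) hδ] with p hp
  rw [Metric.mem_ball, Prod.dist_eq, max_lt_iff, dist_eq_norm, dist_eq_norm] at hp
  exact hLip x y p.1 p.2
    ((Metric.closedBall_subset_closedBall (by linarith [min_le_left r s])).trans hrx)
    ((Metric.closedBall_subset_closedBall (by linarith [min_le_right r s])).trans hsy) hp.1 hp.2

end IsGreenRegularPart

theorem continuous_mul_of_tsupport_subset {X : Type*} [TopologicalSpace X] {s : Set X}
    (hs : IsOpen s) {w h : X → ℝ} (hw : Continuous w) (hws : tsupport w ⊆ s)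
    (hh : ContinuousOn h s) : Continuous fun x => w x * h x := by
  refine continuous_of_tsupport fun x hx => ?_
  have hxs : x ∈ s := hws (closure_mono (Function.support_mul_subset_left w h) hx)
  exact hw.continuousAt.mul (hh.continuousAt (hs.mem_nhds hxs))

theorem continuousOn_fderiv_fderiv {E : Type*} [NormedAddCommGroup E] [NormedSpace ℝ E]
    {Ω : Set E} {u : E → ℝ} (ho : IsOpen Ω) (hu : ContDiffOn ℝ 2 u Ω) :
    ContinuousOn (fderiv ℝ (fderiv ℝ u)) Ω :=
  (hu.fderiv_of_isOpen (m := 1) ho (by norm_num)).continuousOn_fderiv_of_isOpen ho le_rfl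

section Dirichlet

variable {E : Type*} [NormedAddCommGroup E] [InnerProductSpace ℝ E] [FiniteDimensional ℝ E]
  {Ω : Set E} {u w : E → ℝ}

theorem laplacian_eq_sum_fderiv_fderiv (u : E → ℝ) (x : E) :
    Laplacian.laplacian u x = ∑ i, fderiv ℝ (fderiv ℝ u) x
      (stdOrthonormalBasis ℝ E i) (stdOrthonormalBasis ℝ E i) := by
  simp [laplacian_eq_iteratedFDeriv_stdOrthonormalBasis, iteratedFDeriv_two_apply]

theorem continuousOn_laplacian (ho : IsOpen Ω) (hu : ContDiffOn ℝ 2 u Ω) :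
    ContinuousOn (Laplacian.laplacian u) Ω := by
  have := continuousOn_fderiv_fderiv ho hu
  rw [funext (laplacian_eq_sum_fderiv_fderiv u)]
  fun_prop

variable [MeasurableSpace E] [BorelSpace E] (μ : Measure E) [μ.IsAddHaarMeasure]

theorem integral_mul_fderiv_fderiv (ho : IsOpen Ω) (hw : ContDiff ℝ 1 w)
    (hc : HasCompactSupport w) (hs : tsupport w ⊆ Ω) (hu : ContDiffOn ℝ 2 u Ω) (v : E) :
    ∫ x, w x * fderiv ℝ (fderiv ℝ u) x v v ∂μ = -∫ x, fderiv ℝ w x v * fderiv ℝ u x v ∂μ := by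
  have hdu : ContDiffOn ℝ 1 (fderiv ℝ u) Ω := hu.fderiv_of_isOpen ho (by norm_num)
  have hdiff : ∀ x ∈ Ω, DifferentiableAt ℝ (fderiv ℝ u) x := fun x hx =>
    (hdu.differentiableOn (by norm_num)).differentiableAt (ho.mem_nhds hx)
  have hduv : ContinuousOn (fun x => fderiv ℝ u x v) Ω :=
    hdu.continuousOn.clm_apply continuousOn_const
  have hint : ∀ h : E → ℝ, ContinuousOn h Ω → Integrable (fun x => w x * h x) μ := fun h hh =>
    (continuous_mul_of_tsupport_subset ho hw.continuous hs hh).integrable_of_hasCompactSupport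
      hc.mul_right
  have hdw : Continuous fun x => fderiv ℝ w x v :=
    (hw.continuous_fderiv (by norm_num)).clm_apply continuous_const
  have hintd : Integrable (fun x => fderiv ℝ w x v * fderiv ℝ u x v) μ :=
    (continuous_mul_of_tsupport_subset ho hdw ((tsupport_fderiv_apply_subset ℝ v).trans hs)
      hduv).integrable_of_hasCompactSupport (hc.fderiv_apply ℝ v).mul_right
  have heq : (fun x => w x * fderiv ℝ (fderiv ℝ u) x v v)
      = fun x => w x * fderiv ℝ (fun y => fderiv ℝ u y v) x v := by
    funext x
    by_cases hx : x ∈ Ω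
    · rw [fderiv_clm_apply (hdiff x hx) (differentiableAt_const v)]
      simp
    · simp [image_eq_zero_of_notMem_tsupport fun h => hx (hs h)]
  have hintdd : Integrable (fun x => w x * fderiv ℝ (fun y => fderiv ℝ u y v) x v) μ :=
    heq ▸ hint _ (((continuousOn_fderiv_fderiv ho hu).clm_apply continuousOn_const).clm_apply
      continuousOn_const)
  rw [heq]
  exact integral_mul_fderiv_eq_neg_fderiv_mul_of_integrable hintd hintdd (hint _ hduv)
    (fun x _ => hw.differentiable (by norm_num) x)
    (fun x hx => (hdiff x (hs hx)).clm_apply (differentiableAt_const v))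

theorem integral_mul_laplacian (ho : IsOpen Ω) (hw : ContDiff ℝ 1 w)
    (hc : HasCompactSupport w) (hs : tsupport w ⊆ Ω) (hu : ContDiffOn ℝ 2 u Ω) :
    ∫ x, w x * Laplacian.laplacian u x ∂μ = -∑ i, ∫ x, fderiv ℝ w x (stdOrthonormalBasis ℝ E i) *
      fderiv ℝ u x (stdOrthonormalBasis ℝ E i) ∂μ := by
  simp only [laplacian_eq_sum_fderiv_fderiv, Finset.mul_sum]
  rw [integral_finsetSum, ← Finset.sum_neg_distrib]
  · exact Finset.sum_congr rfl fun i _ => integral_mul_fderiv_fderiv μ ho hw hc hs hu _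
  · intro i _
    have := continuousOn_fderiv_fderiv ho hu
    exact (continuous_mul_of_tsupport_subset ho hw.continuous hs
      (by fun_prop)).integrable_of_hasCompactSupport hc.mul_right

end Dirichlet

/-- A smooth nondecreasing function of `t` that vanishes for `|t| ≤ ε` and is uniformly close to
the identity. -/
noncomputable def softThreshold (ε t : ℝ) : ℝ := t * Real.smoothTransition (t ^ 2 / ε ^ 2 - 1)

theorem contDiff_softThreshold (ε : ℝ) : ContDiff ℝ 1 (softThreshold ε) := by
  refine contDiff_id.mul ((Real.smoothTransition.contDiff (n := 1)).comp ?_)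
  fun_prop

theorem deriv_softThreshold_nonneg (ε t : ℝ) : 0 ≤ deriv (softThreshold ε) t := by
  have harg : HasDerivAt (fun t : ℝ => t ^ 2 / ε ^ 2 - 1) (2 * t / ε ^ 2) t := by
    simpa using ((hasDerivAt_pow 2 t).div_const (ε ^ 2)).sub_const 1
  have htrans : DifferentiableAt ℝ Real.smoothTransition (t ^ 2 / ε ^ 2 - 1) :=
    (Real.smoothTransition.contDiff (n := 1)).differentiable (by norm_num) _
  have hderiv : deriv (softThreshold ε) t = Real.smoothTransition (t ^ 2 / ε ^ 2 - 1) +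
      deriv Real.smoothTransition (t ^ 2 / ε ^ 2 - 1) * (2 * t ^ 2 / ε ^ 2) := by
    refine ((hasDerivAt_id t).mul (htrans.hasDerivAt.comp t harg)).deriv.trans ?_
    simp only [id, Function.comp, one_mul]
    ring
  rw [hderiv]
  have := Real.smoothTransition.monotone.deriv_nonneg (x := t ^ 2 / ε ^ 2 - 1)
  have := Real.smoothTransition.nonneg (t ^ 2 / ε ^ 2 - 1)
  positivity

theorem softThreshold_eq_zero {ε t : ℝ} (hε : 0 < ε) (h : |t| ≤ ε) : softThreshold ε t = 0 := by
  rw [softThreshold, Real.smoothTransition.zero_of_nonpos, mul_zero]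
  rw [sub_nonpos, div_le_one (by positivity)]
  exact sq_le_sq' (abs_le.1 h).1 (abs_le.1 h).2

theorem abs_softThreshold_sub_le {ε : ℝ} (hε : 0 < ε) (t : ℝ) :
    |softThreshold ε t - t| ≤ 2 * ε := by
  rw [softThreshold, ← mul_sub_one, abs_mul]
  rcases le_total |t| (2 * ε) with h | h
  · have h0 := Real.smoothTransition.nonneg (t ^ 2 / ε ^ 2 - 1)
    have h1 := Real.smoothTransition.le_one (t ^ 2 / ε ^ 2 - 1)
    exact (mul_le_of_le_one_right (abs_nonneg t) (abs_le.2 ⟨by linarith, by linarith⟩)).trans h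
  · have hsq : (2 * ε) ^ 2 ≤ t ^ 2 := by
      rw [← sq_abs t]
      gcongr
    rw [Real.smoothTransition.one_of_one_le, sub_self, abs_zero, mul_zero]
    · positivity
    · rw [le_sub_iff_add_le, le_div_iff₀ (by positivity)]
      nlinarith

section Truncation

variable {E : Type*} [NormedAddCommGroup E] {Ω : Set E} {u : E → ℝ} {ε : ℝ}

theorem exists_isCompact_support_indicator_softThreshold [ProperSpace E]
    (ho : IsOpen Ω) (hb : Bornology.IsBounded Ω) (hc : ContinuousOn u (closure Ω))
    (h0 : ∀ x ∈ frontier Ω, u x = 0) (hε : 0 < ε) :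
    ∃ K, IsCompact K ∧ K ⊆ Ω ∧ tsupport (Ω.indicator (softThreshold ε ∘ u)) ⊆ K := by
  set K : Set E := closure Ω ∩ u ⁻¹' {t | ε ≤ |t|}
  have hcl : IsClosed K := hc.preimage_isClosed_of_isClosed isClosed_closure
    (isClosed_le continuous_const continuous_abs)
  refine ⟨K, hb.isCompact_closure.of_isClosed_subset hcl Set.inter_subset_left,
    fun x hx => ?_, closure_minimal (fun x hx => ?_) hcl⟩
  · by_contra hn
    have hux : ε ≤ |u x| := hx.2
    rw [h0 x (ho.frontier_eq ▸ Set.mem_sdiff_of_mem hx.1 hn), abs_zero] at hux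
    exact hux.not_gt hε
  · have hxΩ : x ∈ Ω := Set.mem_of_indicator_ne_zero hx
    have hxu : ε ≤ |u x| := by
      by_contra! h
      exact hx (by rw [Set.indicator_of_mem hxΩ, Function.comp_apply,
        softThreshold_eq_zero hε h.le])
    exact ⟨subset_closure hxΩ, hxu⟩

variable [NormedSpace ℝ E]

theorem contDiff_indicator_softThreshold (ho : IsOpen Ω) (hu : ContDiffOn ℝ 2 u Ω)
    (hs : tsupport (Ω.indicator (softThreshold ε ∘ u)) ⊆ Ω) :
    ContDiff ℝ 1 (Ω.indicator (softThreshold ε ∘ u)) := by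
  refine contDiff_iff_contDiffAt.2 fun x => ?_
  by_cases hx : x ∈ Ω
  · exact ((contDiff_softThreshold ε).contDiffAt.comp x
      (((hu x hx).contDiffAt (ho.mem_nhds hx)).of_le (by norm_num))).congr_of_eventuallyEq
      (Set.eqOn_indicator.eventuallyEq_of_mem (ho.mem_nhds hx))
  · exact contDiffAt_const.congr_of_eventuallyEq
      (notMem_tsupport_iff_eventuallyEq.1 fun h => hx (hs h))

theorem fderiv_indicator_softThreshold (ho : IsOpen Ω) (hu : ContDiffOn ℝ 2 u Ω) {x : E}
    (hx : x ∈ Ω) : fderiv ℝ (Ω.indicator (softThreshold ε ∘ u)) x =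
      deriv (softThreshold ε) (u x) • fderiv ℝ u x := by
  have hux : DifferentiableAt ℝ u x :=
    ((hu x hx).contDiffAt (ho.mem_nhds hx)).differentiableAt (by norm_num)
  have hdiff : DifferentiableAt ℝ (softThreshold ε) (u x) :=
    (contDiff_softThreshold ε).differentiable (by norm_num) _
  rw [(Set.eqOn_indicator.eventuallyEq_of_mem (ho.mem_nhds hx)).fderiv_eq]
  exact (hdiff.hasDerivAt.comp_hasFDerivAt x hux.hasFDerivAt).fderiv

end Truncation

section DirichletEnergy

variable {E : Type*} [NormedAddCommGroup E] [InnerProductSpace ℝ E] [FiniteDimensional ℝ E]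
  [MeasurableSpace E] [BorelSpace E] (μ : Measure E) [μ.IsAddHaarMeasure]
  {Ω : Set E} {u : E → ℝ} {ε : ℝ}

theorem integral_indicator_softThreshold_mul_laplacian_nonpos (ho : IsOpen Ω)
    (hu : ContDiffOn ℝ 2 u Ω) (hc : HasCompactSupport (Ω.indicator (softThreshold ε ∘ u)))
    (hs : tsupport (Ω.indicator (softThreshold ε ∘ u)) ⊆ Ω) :
    ∫ x, Ω.indicator (softThreshold ε ∘ u) x * Laplacian.laplacian u x ∂μ ≤ 0 := by
  rw [integral_mul_laplacian μ ho (contDiff_indicator_softThreshold ho hu hs) hc hs hu]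
  refine neg_nonpos.2 (Finset.sum_nonneg fun i _ => integral_nonneg fun x => ?_)
  by_cases hx : x ∈ Ω
  · simp only [Pi.zero_apply, fderiv_indicator_softThreshold ho hu hx, smul_apply, smul_eq_mul,
      mul_assoc]
    exact mul_nonneg (deriv_softThreshold_nonneg _ _) (mul_self_nonneg _)
  · have hzero : fderiv ℝ (Ω.indicator (softThreshold ε ∘ u)) x = 0 :=
      image_eq_zero_of_notMem_tsupport fun h => hx (hs (tsupport_fderiv_subset ℝ h))
    simp [hzero]

theorem setIntegral_mul_laplacian_nonpos (ho : IsOpen Ω) (hb : Bornology.IsBounded Ω)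
    (hu : ContDiffOn ℝ 2 u Ω) (hc : ContinuousOn u (closure Ω)) (h0 : ∀ x ∈ frontier Ω, u x = 0)
    (hint : IntegrableOn (Laplacian.laplacian u) Ω μ) :
    ∫ x in Ω, u x * Laplacian.laplacian u x ∂μ ≤ 0 := by
  obtain ⟨B, hB⟩ := hb.isCompact_closure.exists_bound_of_continuousOn hc
  have hintu : IntegrableOn (fun x => u x * Laplacian.laplacian u x) Ω μ :=
    hint.bdd_mul (hu.continuousOn.aestronglyMeasurable ho.measurableSet) (c := B)
      ((ae_restrict_mem ho.measurableSet).mono fun x hx => hB x (subset_closure hx))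
  set N := ∫ x in Ω, ‖Laplacian.laplacian u x‖ ∂μ
  have hbound : ∀ ε > 0, ∫ x in Ω, u x * Laplacian.laplacian u x ∂μ ≤ 2 * ε * N := by
    intro ε hε
    obtain ⟨K, hK, hKΩ, hwK⟩ := exists_isCompact_support_indicator_softThreshold ho hb hc h0 hε
    set w := Ω.indicator (softThreshold ε ∘ u)
    have hwc : HasCompactSupport w := hK.of_isClosed_subset (isClosed_tsupport _) hwK
    have hws : tsupport w ⊆ Ω := hwK.trans hKΩ
    have hintw : IntegrableOn (fun x => w x * Laplacian.laplacian u x) Ω μ :=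
      ((continuous_mul_of_tsupport_subset ho
        (contDiff_indicator_softThreshold ho hu hws).continuous hws
        (continuousOn_laplacian ho hu)).integrable_of_hasCompactSupport
          hwc.mul_right).integrableOn
    have hw_nonpos : ∫ x in Ω, w x * Laplacian.laplacian u x ∂μ ≤ 0 := by
      rw [setIntegral_eq_integral_of_forall_compl_eq_zero fun x hx =>
        mul_eq_zero_of_left (Set.indicator_of_notMem hx _) _]
      exact integral_indicator_softThreshold_mul_laplacian_nonpos μ ho hu hwc hws
    have hdiff : ∫ x in Ω, u x * Laplacian.laplacian u x - w x * Laplacian.laplacian u x ∂μ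
        ≤ ∫ x in Ω, 2 * ε * ‖Laplacian.laplacian u x‖ ∂μ := by
      refine setIntegral_mono_on (hintu.sub hintw) (hint.norm.const_mul _) ho.measurableSet
        fun x hx => ?_
      have hwx : w x = softThreshold ε (u x) := Set.indicator_of_mem hx _
      rw [← sub_mul, hwx]
      refine (le_abs_self _).trans ?_
      rw [abs_mul, abs_sub_comm, Real.norm_eq_abs]
      gcongr
      exact abs_softThreshold_sub_le hε _
    rw [integral_sub hintu hintw, integral_const_mul] at hdiff
    linarith
  have hlim : Filter.Tendsto (fun ε => 2 * ε * N) (𝓝[>] 0) (𝓝 0) :=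
    (Continuous.tendsto' (by fun_prop) _ _ (by simp)).mono_left nhdsWithin_le_nhds
  exact ge_of_tendsto hlim (Filter.eventually_of_mem self_mem_nhdsWithin hbound)

end DirichletEnergy

theorem hasDerivAt_ite_lt {f₁ f₂ : ℝ → ℝ} {a d s : ℝ} (h₁ : s ≤ a → HasDerivAt f₁ d s)
    (h₂ : a ≤ s → HasDerivAt f₂ d s) (h : f₁ a = f₂ a) :
    HasDerivAt (fun t => if t < a then f₁ t else f₂ t) d s := by
  rcases lt_trichotomy s a with hs | rfl | hs
  · refine (h₁ hs.le).congr_of_eventuallyEq ?_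
    filter_upwards [Iio_mem_nhds hs] with t ht using if_pos ht
  · rw [← hasDerivWithinAt_univ, ← Set.Iic_union_Ici (a := s)]
    refine .union ((h₁ le_rfl).hasDerivWithinAt.congr (fun t ht => ?_) (by simp [h]))
      ((h₂ le_rfl).hasDerivWithinAt.congr (fun t ht => if_neg (not_lt.2 ht)) (by simp))
    rcases (Set.mem_Iic.1 ht).lt_or_eq with hts | rfl
    · exact if_pos hts
    · simp [h]
  · refine (h₂ hs.le).congr_of_eventuallyEq ?_
    filter_upwards [Ioi_mem_nhds hs] with t ht using if_neg (not_lt.2 (Set.mem_Ioi.1 ht).le)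

/-- A `C²` function that agrees with the logarithm on `[1, ∞)`; on `(-∞, 1)` it is the second order
Taylor polynomial of the logarithm at `1`. -/
noncomputable def cutoffLog (s : ℝ) : ℝ :=
  if s < 1 then (s - 1) - (s - 1) ^ 2 / 2 else Real.log s

/-- The derivative of `cutoffLog`. -/
noncomputable def cutoffLogDeriv (s : ℝ) : ℝ := if s < 1 then 2 - s else s⁻¹

theorem hasDerivAt_cutoffLog (s : ℝ) : HasDerivAt cutoffLog (cutoffLogDeriv s) s := by
  refine hasDerivAt_ite_lt (fun hs => ?_) (fun hs => ?_) (by simp)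
  · have hsub : HasDerivAt (fun t : ℝ => t - 1) 1 s := (hasDerivAt_id s).sub_const 1
    refine (hsub.sub ((hsub.pow 2).div_const 2)).congr_deriv ?_
    rw [cutoffLogDeriv]
    split_ifs with h
    · simp; ring
    · simp [le_antisymm hs (not_lt.1 h)]
  · simpa [cutoffLogDeriv, not_lt.2 hs] using Real.hasDerivAt_log (by linarith : s ≠ 0)

theorem hasDerivAt_cutoffLogDeriv (s : ℝ) :
    HasDerivAt cutoffLogDeriv (-(max s 1 ^ 2)⁻¹) s := by
  refine hasDerivAt_ite_lt (fun hs => ?_) (fun hs => ?_) (by norm_num)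
  · simpa [max_eq_right hs] using (hasDerivAt_id s).const_sub 2
  · simpa [max_eq_left hs] using hasDerivAt_inv (by linarith : s ≠ 0)

theorem contDiff_cutoffLog : ContDiff ℝ 2 cutoffLog := by
  have hderiv : ContDiff ℝ 1 cutoffLogDeriv := by
    rw [contDiff_one_iff_deriv, funext fun s => (hasDerivAt_cutoffLogDeriv s).deriv]
    refine ⟨fun s => (hasDerivAt_cutoffLogDeriv s).differentiableAt, ?_⟩
    exact (((continuous_id.max continuous_const).pow 2).inv₀ fun s =>
      (pow_pos (lt_max_of_lt_right one_pos) 2).ne').neg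
  rw [show (2 : WithTop ℕ∞) = 1 + 1 from rfl, contDiff_succ_iff_deriv,
    funext fun s => (hasDerivAt_cutoffLog s).deriv]
  exact ⟨fun s => (hasDerivAt_cutoffLog s).differentiableAt, by simp, hderiv⟩

theorem cutoffLogDeriv_sub_mul_inv_sq (s : ℝ) :
    cutoffLogDeriv s - s * (max s 1 ^ 2)⁻¹ = 2 * max 0 (1 - s) := by
  rcases lt_or_ge s 1 with h | h
  · rw [cutoffLogDeriv, if_pos h, max_eq_right h.le, max_eq_right (by linarith)]
    ring
  · have hs : s ≠ 0 := by positivity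
    rw [cutoffLogDeriv, if_neg h.not_gt, max_eq_left h, max_eq_left (by linarith)]
    field_simp
    ring

section Radial

variable {E : Type*} [NormedAddCommGroup E] [InnerProductSpace ℝ E]

theorem hasFDerivAt_norm_sub_sq (c x : E) :
    HasFDerivAt (fun y => ‖y - c‖ ^ 2) (2 • innerSL ℝ (x - c)) x := by
  have hsub : HasFDerivAt (fun y : E => y - c) (ContinuousLinearMap.id ℝ E) x :=
    (hasFDerivAt_id x).sub_const c
  simpa using hsub.norm_sq

variable [FiniteDimensional ℝ E]

theorem laplacian_comp_norm_sub_sq {φ φ' : ℝ → ℝ} {φ'' : ℝ} {c x : E}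
    (hφ : ∀ s, HasDerivAt φ (φ' s) s) (hφ' : HasDerivAt φ' φ'' (‖x - c‖ ^ 2)) :
    Laplacian.laplacian (fun y => φ (‖y - c‖ ^ 2)) x =
      4 * ‖x - c‖ ^ 2 * φ'' + 2 * Module.finrank ℝ E * φ' (‖x - c‖ ^ 2) := by
  have hfderiv : fderiv ℝ (fun y => φ (‖y - c‖ ^ 2)) =
      fun y => φ' (‖y - c‖ ^ 2) • 2 • innerSL ℝ (y - c) := by
    funext y
    exact ((hφ _).comp_hasFDerivAt y (hasFDerivAt_norm_sub_sq c y)).fderiv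
  have hinner : HasFDerivAt (fun y => 2 • innerSL ℝ (y - c)) (2 • innerSL ℝ) x :=
    ((innerSL ℝ).hasFDerivAt.comp x ((hasFDerivAt_id x).sub_const c)).const_smul 2
  have hsecond : fderiv ℝ (fderiv ℝ fun y => φ (‖y - c‖ ^ 2)) x =
      φ' (‖x - c‖ ^ 2) • 2 • innerSL ℝ +
        (φ'' • 2 • innerSL ℝ (x - c)).smulRight (2 • innerSL ℝ (x - c)) := by
    rw [hfderiv]
    exact ((hφ'.comp_hasFDerivAt x (hasFDerivAt_norm_sub_sq c x)).smul hinner).fderiv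
  have hterm : ∀ i, fderiv ℝ (fderiv ℝ fun y => φ (‖y - c‖ ^ 2)) x
      (stdOrthonormalBasis ℝ E i) (stdOrthonormalBasis ℝ E i) =
      2 * φ' (‖x - c‖ ^ 2) + 4 * φ'' * inner ℝ (x - c) (stdOrthonormalBasis ℝ E i) ^ 2 := by
    intro i
    have hunit : innerSL ℝ (stdOrthonormalBasis ℝ E i) (stdOrthonormalBasis ℝ E i) = (1 : ℝ) := by
      simp [innerSL_apply_apply]
    simp only [hsecond, add_apply, smul_apply,
      ContinuousLinearMap.smulRight_apply, hunit, innerSL_apply_apply, nsmul_eq_mul, smul_eq_mul]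
    push_cast
    ring
  rw [laplacian_eq_sum_fderiv_fderiv, Finset.sum_congr rfl fun i _ => hterm i,
    Finset.sum_add_distrib, ← Finset.mul_sum _ _ (4 * φ''),
    (stdOrthonormalBasis ℝ E).sum_sq_inner_left]
  simp only [Finset.sum_const, Finset.card_univ, Fintype.card_fin, nsmul_eq_mul]
  ring

end Radial

theorem laplacian_finsetSum {ι E F : Type*} [NormedAddCommGroup E] [InnerProductSpace ℝ E]
    [FiniteDimensional ℝ E] [NormedAddCommGroup F] [NormedSpace ℝ F] (s : Finset ι)
    {f : ι → E → F} {x : E} (h : ∀ i ∈ s, ContDiffAt ℝ 2 (f i) x) :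
    Laplacian.laplacian (fun y => ∑ i ∈ s, f i y) x = ∑ i ∈ s, Laplacian.laplacian (f i) x := by
  simp only [laplacian_eq_iteratedFDeriv_stdOrthonormalBasis, iteratedFDeriv_fun_sum_apply h,
    sum_apply]
  exact Finset.sum_comm

theorem neg_three_halves_le_cutoffLog {s : ℝ} (hs : 0 ≤ s) : -(3 / 2) ≤ cutoffLog s := by
  rw [cutoffLog]
  split_ifs with h
  · nlinarith
  · have := Real.log_nonneg (not_lt.1 h)
    linarith

/-- The function that agrees with `2 log (‖x - c‖ / r)` outside the disc of radius `r` around `c`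
and is smoothed inside: up to a factor, the logarithmic potential of `smearedDensity c r`. -/
noncomputable def smearedLog (c : ℂ) (r : ℝ) (x : ℂ) : ℝ := cutoffLog (‖x - c‖ ^ 2 / r ^ 2)

/-- A continuous radial probability density supported in the disc of radius `r` around `c`. -/
noncomputable def smearedDensity (c : ℂ) (r : ℝ) (x : ℂ) : ℝ :=
  2 / (Real.pi * r ^ 2) * max 0 (1 - ‖x - c‖ ^ 2 / r ^ 2)

section Smeared

variable {c x : ℂ} {r : ℝ}

theorem contDiff_smearedLog (c : ℂ) (r : ℝ) : ContDiff ℝ 2 (smearedLog c r) :=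
  contDiff_cutoffLog.comp (((contDiff_id.sub contDiff_const).norm_sq ℝ).div_const _)

theorem smearedLog_of_le (hr : 0 < r) (h : r ≤ ‖x - c‖) :
    smearedLog c r x = 2 * Real.log ‖x - c‖ - 2 * Real.log r := by
  have hx : ‖x - c‖ ≠ 0 := (hr.trans_le h).ne'
  have hle : ¬ ‖x - c‖ ^ 2 / r ^ 2 < 1 := by
    rw [not_lt, one_le_div (by positivity)]
    gcongr
  rw [smearedLog, cutoffLog, if_neg hle, Real.log_div (by positivity) (by positivity),
    Real.log_pow, Real.log_pow]
  norm_num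

theorem laplacian_smearedLog (hr : 0 < r) (x : ℂ) :
    Laplacian.laplacian (smearedLog c r) x = 4 * Real.pi * smearedDensity c r x := by
  have hφ : ∀ t, HasDerivAt (cutoffLog ∘ fun t => t / r ^ 2)
      (cutoffLogDeriv (t / r ^ 2) * (1 / r ^ 2)) t := fun t =>
    (hasDerivAt_cutoffLog (t / r ^ 2)).comp t ((hasDerivAt_id t).div_const (r ^ 2))
  have hφ' := ((hasDerivAt_cutoffLogDeriv (‖x - c‖ ^ 2 / r ^ 2)).comp (‖x - c‖ ^ 2)
    ((hasDerivAt_id _).div_const (r ^ 2))).mul_const (1 / r ^ 2)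
  have hmax : max 0 (1 - ‖x - c‖ ^ 2 / r ^ 2) = (cutoffLogDeriv (‖x - c‖ ^ 2 / r ^ 2) -
      ‖x - c‖ ^ 2 / r ^ 2 * (max (‖x - c‖ ^ 2 / r ^ 2) 1 ^ 2)⁻¹) / 2 := by
    linarith [cutoffLogDeriv_sub_mul_inv_sq (‖x - c‖ ^ 2 / r ^ 2)]
  refine (laplacian_comp_norm_sub_sq hφ hφ').trans ?_
  rw [smearedDensity, hmax, Complex.finrank_real_complex]
  field_simp
  ring

theorem continuous_smearedDensity (c : ℂ) (r : ℝ) : Continuous (smearedDensity c r) := by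
  unfold smearedDensity
  fun_prop

theorem smearedDensity_nonneg (c : ℂ) (r : ℝ) (x : ℂ) : 0 ≤ smearedDensity c r x := by
  unfold smearedDensity
  positivity

theorem tsupport_smearedDensity_subset (hr : 0 < r) :
    tsupport (smearedDensity c r) ⊆ Metric.closedBall c r := by
  refine closure_minimal (fun x hx => ?_) Metric.isClosed_closedBall
  by_contra hn
  rw [Metric.mem_closedBall, dist_eq_norm, not_le] at hn
  have hone : 1 ≤ ‖x - c‖ ^ 2 / r ^ 2 := by
    rw [one_le_div (by positivity)]
    gcongr
  exact hx (by rw [smearedDensity, max_eq_left (by linarith), mul_zero])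

theorem integrable_smearedDensity_mul (hr : 0 < r) {s : Set ℂ} (hs : IsOpen s)
    (hball : Metric.closedBall c r ⊆ s) {h : ℂ → ℝ} (hh : ContinuousOn h s) :
    Integrable fun x => smearedDensity c r x * h x := by
  have hsupp := tsupport_smearedDensity_subset (c := c) hr
  exact (continuous_mul_of_tsupport_subset hs (continuous_smearedDensity c r) (hsupp.trans hball)
    hh).integrable_of_hasCompactSupport
      (HasCompactSupport.of_support_subset_isCompact (isCompact_closedBall c r)
        ((subset_tsupport _).trans hsupp)).mul_right

end Smeared

theorem integral_polarCoord_symm_of_harmonicOnNhd {c : ℂ} {t : ℝ} (ht : 0 ≤ t) {h : ℂ → ℝ}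
    (hh : HarmonicOnNhd h (Metric.closedBall c t)) :
    ∫ θ in Set.Ioo (-Real.pi) Real.pi, h (c + Complex.polarCoord.symm (t, θ)) =
      2 * Real.pi * h c := by
  have hpi := Real.pi_pos
  have hmean : Real.circleAverage h c t = h c :=
    InnerProductSpace.HarmonicOnNhd.circleAverage_eq (by rwa [abs_of_nonneg ht])
  have hperiodic : Function.Periodic (fun θ => h (circleMap c t θ)) (2 * Real.pi) := fun θ => by
    simp only [periodic_circleMap c t θ]
  have hshift := hperiodic.intervalIntegral_add_eq 0 (-Real.pi)
  rw [zero_add, show -Real.pi + 2 * Real.pi = Real.pi by ring] at hshift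
  calc ∫ θ in Set.Ioo (-Real.pi) Real.pi, h (c + Complex.polarCoord.symm (t, θ))
      = ∫ θ in (-Real.pi)..Real.pi, h (circleMap c t θ) := by
        rw [intervalIntegral.integral_of_le (by linarith), integral_Ioc_eq_integral_Ioo]
        simp [Complex.polarCoord_symm_apply, circleMap, Complex.exp_mul_I]
    _ = 2 * Real.pi * h c := by
        rw [← hshift, ← hmean, Real.circleAverage, smul_eq_mul]
        field_simp

theorem integrableOn_polarCoord_symm_of_continuousOn {c : ℂ} {r : ℝ} {w : ℝ → ℝ}
    (hw : Continuous w) {h : ℂ → ℝ} (hh : ContinuousOn h (Metric.closedBall c r)) :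
    IntegrableOn (fun p : ℝ × ℝ => p.1 * w p.1 * h (c + Complex.polarCoord.symm p))
      (Set.Ioo 0 r ×ˢ Set.Ioo (-Real.pi) Real.pi) := by
  have hcont : ContinuousOn (fun p : ℝ × ℝ => p.1 * w p.1 * h (c + Complex.polarCoord.symm p))
      (Set.Icc 0 r ×ˢ Set.Icc (-Real.pi) Real.pi) := by
    refine ContinuousOn.mul (by fun_prop) (hh.comp ?_ ?_)
    · simp only [Complex.polarCoord_symm_apply]
      fun_prop
    · rintro p ⟨hp, -⟩
      rw [Metric.mem_closedBall, dist_eq_norm, add_sub_cancel_left,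
        Complex.norm_polarCoord_symm, abs_of_nonneg hp.1]
      exact hp.2
  exact (hcont.integrableOn_compact (μ := volume)
    (isCompact_Icc.prod isCompact_Icc)).mono_set
      (Set.prod_mono Set.Ioo_subset_Icc_self Set.Ioo_subset_Icc_self)

theorem integral_norm_sub_mul_of_harmonicOnNhd {c : ℂ} {r : ℝ} (hr : 0 ≤ r) {w : ℝ → ℝ}
    (hw : Continuous w) (hwr : ∀ t, r ≤ t → w t = 0) {h : ℂ → ℝ}
    (hh : HarmonicOnNhd h (Metric.closedBall c r)) :
    ∫ x, w ‖x - c‖ * h x = (2 * Real.pi * ∫ t in (0 : ℝ)..r, t * w t) * h c := by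
  have hpolar : ∀ p ∈ polarCoord.target,
      p.1 • (w ‖c + Complex.polarCoord.symm p - c‖ * h (c + Complex.polarCoord.symm p)) =
        p.1 * w p.1 * h (c + Complex.polarCoord.symm p) := by
    intro p hp
    rw [add_sub_cancel_left, Complex.norm_polarCoord_symm, abs_of_pos (by simpa using hp.1),
      smul_eq_mul, mul_assoc]
  have hzero : ∀ p ∈ polarCoord.target \ Set.Ioo 0 r ×ˢ Set.Ioo (-Real.pi) Real.pi,
      p.1 * w p.1 * h (c + Complex.polarCoord.symm p) = 0 := by
    rintro p ⟨⟨hp1, hp2⟩, hp⟩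
    rw [hwr p.1 (not_lt.1 fun hpr => hp ⟨⟨hp1, hpr⟩, hp2⟩)]
    ring
  calc ∫ x, w ‖x - c‖ * h x
      = ∫ p in polarCoord.target, p.1 * w p.1 * h (c + Complex.polarCoord.symm p) := by
        rw [← integral_add_left_eq_self (fun x => w ‖x - c‖ * h x) c,
          ← Complex.integral_comp_polarCoord_symm]
        exact setIntegral_congr_fun polarCoord.open_target.measurableSet hpolar
    _ = ∫ p in Set.Ioo 0 r ×ˢ Set.Ioo (-Real.pi) Real.pi,
          p.1 * w p.1 * h (c + Complex.polarCoord.symm p) := by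
        refine setIntegral_eq_of_subset_of_forall_sdiff_eq_zero
          polarCoord.open_target.measurableSet ?_ hzero
        exact Set.prod_mono Set.Ioo_subset_Ioi_self subset_rfl
    _ = ∫ t in Set.Ioo 0 r, t * w t * (2 * Real.pi * h c) := by
        rw [Measure.volume_eq_prod, setIntegral_prod _
          (integrableOn_polarCoord_symm_of_continuousOn hw hh.continuousOn)]
        refine setIntegral_congr_fun measurableSet_Ioo fun t ht => ?_
        simp only [integral_const_mul]
        rw [integral_polarCoord_symm_of_harmonicOnNhd ht.1.le
          (hh.mono (Metric.closedBall_subset_closedBall ht.2.le))]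
    _ = (2 * Real.pi * ∫ t in (0 : ℝ)..r, t * w t) * h c := by
        rw [integral_mul_const, intervalIntegral.integral_of_le hr, integral_Ioc_eq_integral_Ioo]
        ring

theorem integral_smearedDensity_mul {c : ℂ} {r : ℝ} (hr : 0 < r) {h : ℂ → ℝ}
    (hh : HarmonicOnNhd h (Metric.closedBall c r)) :
    ∫ x, smearedDensity c r x * h x = h c := by
  have hradial := integral_norm_sub_mul_of_harmonicOnNhd hr.le
    (w := fun t => 2 / (Real.pi * r ^ 2) * max 0 (1 - t ^ 2 / r ^ 2)) (by fun_prop)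
    (fun t ht => by
      rw [max_eq_left, mul_zero]
      rw [sub_nonpos, one_le_div (by positivity)]
      gcongr) hh
  have hmass : ∫ t in (0 : ℝ)..r, t * (2 / (Real.pi * r ^ 2) * max 0 (1 - t ^ 2 / r ^ 2)) =
      ∫ t in (0 : ℝ)..r, 2 / (Real.pi * r ^ 2) * t - 2 / (Real.pi * r ^ 4) * t ^ 3 := by
    refine intervalIntegral.integral_congr fun t ht => ?_
    rw [Set.uIcc_of_le hr.le] at ht
    have hle : t ^ 2 / r ^ 2 ≤ 1 := by
      rw [div_le_one (by positivity)]
      exact pow_le_pow_left₀ ht.1 ht.2 2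
    simp only [max_eq_right (sub_nonneg.2 hle)]
    field_simp
  refine hradial.trans ?_
  rw [hmass, intervalIntegral.integral_sub (by apply Continuous.intervalIntegrable; fun_prop)
    (by apply Continuous.intervalIntegrable; fun_prop), intervalIntegral.integral_const_mul,
    intervalIntegral.integral_const_mul, integral_id, integral_pow]
  have := Real.pi_pos
  field_simp
  ring

theorem setIntegral_smearedDensity_mul {c : ℂ} {r : ℝ} {s : Set ℂ} (hr : 0 < r)
    (hball : Metric.closedBall c r ⊆ s) (h : ℂ → ℝ) :
    ∫ x in s, smearedDensity c r x * h x = ∫ x, smearedDensity c r x * h x :=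
  setIntegral_eq_integral_of_forall_compl_eq_zero fun x hx => by
    rw [image_eq_zero_of_notMem_tsupport fun h =>
      hx (hball (tsupport_smearedDensity_subset hr h)), zero_mul]

/-- The potential in `Ω`, with zero boundary values, of the unit charge `smearedDensity c r`, where
`g` is the regular part of the Green's function. -/
noncomputable def smearedPotential (g : ℂ → ℂ → ℝ) (c : ℂ) (r : ℝ) (x : ℂ) : ℝ :=
  -(1 / (4 * Real.pi)) * smearedLog c r x - 1 / (2 * Real.pi) * Real.log r + g x c

theorem smearedPotential_of_le (g : ℂ → ℂ → ℝ) {c x : ℂ} {r : ℝ} (hr : 0 < r)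
    (h : r ≤ ‖x - c‖) :
    smearedPotential g c r x = 1 / (2 * Real.pi) * Real.log ‖x - c‖⁻¹ + g x c := by
  rw [smearedPotential, smearedLog_of_le hr h, Real.log_inv]
  have := Real.pi_pos
  field_simp
  ring

section Potential

variable {Ω : Set ℂ} {g : ℂ → ℂ → ℝ} (ho : IsOpen Ω) (hg : IsGreenRegularPart Ω g)
  {c : ℂ} {r : ℝ}

include hg

theorem continuousOn_smearedPotential (hc : c ∈ Ω) :
    ContinuousOn (smearedPotential g c r) (closure Ω) := by
  have hlog := (contDiff_smearedLog c r).continuous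
  have hreg := hg.continuousOn c hc
  unfold smearedPotential
  fun_prop

theorem contDiffOn_smearedPotential (hc : c ∈ Ω) :
    ContDiffOn ℝ 2 (smearedPotential g c r) Ω :=
  ((contDiffOn_const.mul (contDiff_smearedLog c r).contDiffOn).sub contDiffOn_const).add
    (hg.harmonic c hc).contDiffOn

include ho

theorem laplacian_smearedPotential (hr : 0 < r) (hc : c ∈ Ω) {x : ℂ} (hx : x ∈ Ω) :
    Laplacian.laplacian (smearedPotential g c r) x = -smearedDensity c r x := by
  have hdecomp : smearedPotential g c r = ((-(1 / (4 * Real.pi))) • smearedLog c r) +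
      ((fun _ => -(1 / (2 * Real.pi) * Real.log r)) + fun x => g x c) := by
    funext y
    simp only [smearedPotential, Pi.add_apply, Pi.smul_apply, smul_eq_mul]
    ring
  have hlog : ContDiffAt ℝ 2 (smearedLog c r) x := (contDiff_smearedLog c r).contDiffAt
  have hreg : ContDiffAt ℝ 2 (fun x => g x c) x :=
    ((hg.harmonic c hc).contDiffOn x hx).contDiffAt (ho.mem_nhds hx)
  have hreg0 : Laplacian.laplacian (fun x => g x c) x = 0 :=
    (hg.harmonic c hc x hx).2.self_of_nhds
  have hlog' : ContDiffAt ℝ 2 ((-(1 / (4 * Real.pi))) • smearedLog c r) x :=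
    contDiffAt_const.smul hlog
  have hreg' : ContDiffAt ℝ 2
      ((fun _ => -(1 / (2 * Real.pi) * Real.log r)) + fun x => g x c) x :=
    contDiffAt_const.add hreg
  rw [hdecomp, ContDiffAt.laplacian_add hlog' hreg',
    ContDiffAt.laplacian_add contDiffAt_const hreg, laplacian_smul _ hlog, laplacian_const,
    hreg0, laplacian_smearedLog hr, smul_eq_mul]
  simp only [Pi.zero_apply, add_zero]
  have := Real.pi_pos
  field_simp

theorem smearedPotential_eq_zero (hr : 0 < r) (hball : Metric.closedBall c r ⊆ Ω) {x : ℂ}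
    (hx : x ∈ frontier Ω) : smearedPotential g c r x = 0 := by
  have hxΩ : x ∉ Ω := (ho.frontier_eq ▸ hx : x ∈ closure Ω \ Ω).2
  have hxc : r ≤ ‖x - c‖ := by
    by_contra! h
    exact hxΩ (hball (mem_closedBall_iff_norm.2 h.le))
  rw [smearedPotential_of_le g hr hxc,
    hg.boundary c (hball (Metric.mem_closedBall_self hr.le)) x hx]
  ring

theorem integral_smearedDensity_mul_smearedPotential (hb : Bornology.IsBounded Ω) (hr : 0 < r)
    (hball : Metric.closedBall c r ⊆ Ω) {c' : ℂ} {r' : ℝ} (hr' : 0 < r')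
    (hc' : c' ∈ Ω) (hsep : r + r' ≤ ‖c - c'‖) :
    ∫ x, smearedDensity c r x * smearedPotential g c' r' x = greenFunction Ω c c' := by
  have hfar : ∀ y ∈ Metric.closedBall c r, r' ≤ ‖y - c'‖ := by
    intro y hy
    rw [mem_closedBall_iff_norm'] at hy
    linarith [norm_sub_le_norm_sub_add_norm_sub c y c']
  have hharm : HarmonicOnNhd (fun y => 1 / (2 * Real.pi) * Real.log ‖y - c'‖⁻¹ + g y c')
      (Metric.closedBall c r) := by
    intro y hy
    have hne : y - c' ≠ 0 := norm_pos_iff.1 (hr'.trans_le (hfar y hy))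
    have hlog : HarmonicAt (fun y => Real.log ‖y - c'‖) y :=
      AnalyticAt.harmonicAt_log_norm (analyticAt_id.sub analyticAt_const) hne
    convert (hlog.const_smul (c := -(1 / (2 * Real.pi)))).add
      (hg.harmonic c' hc' y (hball hy)) using 1
    funext z
    simp [Real.log_inv]
  rw [greenFunction_eq ho hb hg (hball (Metric.mem_closedBall_self hr.le)) hc',
    ← integral_smearedDensity_mul hr hharm]
  refine integral_congr_ae (.of_forall fun y => ?_)
  by_cases hy : y ∈ Metric.closedBall c r
  · simp only [smearedPotential_of_le g hr' (hfar y hy)]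
  · simp [image_eq_zero_of_notMem_tsupport fun h => hy (tsupport_smearedDensity_subset hr h)]

theorem integral_smearedDensity_mul_smearedPotential_self_le (hr : 0 < r)
    (hball : Metric.closedBall c r ⊆ Ω) :
    ∫ x, smearedDensity c r x * smearedPotential g c r x ≤
      g c c - 1 / (2 * Real.pi) * Real.log r + 3 / (8 * Real.pi) := by
  have hc : c ∈ Ω := hball (Metric.mem_closedBall_self hr.le)
  set h : ℂ → ℝ := fun y => 3 / (8 * Real.pi) - 1 / (2 * Real.pi) * Real.log r + g y c
  have hharm : HarmonicOnNhd h Ω := (harmonicOnNhd_const _).add (hg.harmonic c hc)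
  have hle : ∀ y, smearedPotential g c r y ≤ h y := fun y => by
    have hlog : -(3 / 2) ≤ smearedLog c r y := neg_three_halves_le_cutoffLog (by positivity)
    have hmul : 1 / (4 * Real.pi) * (-(3 / 2)) ≤ 1 / (4 * Real.pi) * smearedLog c r y := by
      gcongr
    have hconst : 1 / (4 * Real.pi) * (-(3 / 2)) = -(3 / (8 * Real.pi)) := by ring
    simp only [smearedPotential, h]
    linarith
  calc ∫ x, smearedDensity c r x * smearedPotential g c r x
      ≤ ∫ x, smearedDensity c r x * h x :=
        integral_mono
          (integrable_smearedDensity_mul hr ho hball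
            (contDiffOn_smearedPotential hg hc).continuousOn)
          (integrable_smearedDensity_mul hr ho hball hharm.continuousOn)
          fun y => mul_le_mul_of_nonneg_left (hle y) (smearedDensity_nonneg c r y)
    _ = h c := integral_smearedDensity_mul hr (hharm.mono hball)
    _ = g c c - 1 / (2 * Real.pi) * Real.log r + 3 / (8 * Real.pi) := by
        simp only [h]
        ring

end Potential

theorem greenFunction_comm (Ω : Set ℂ) {x y : ℂ} (hx : x ∈ Ω) (hy : y ∈ Ω) :
    greenFunction Ω x y = greenFunction Ω y x := by
  unfold greenFunction
  split_ifs with h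
  · rw [norm_sub_rev, h.choose_spec.symm x hx y hy]
  · rfl

theorem sum_sum_eq_sum_diag_add_two_mul_sum_Ioi {ι R : Type*} [LinearOrder ι] [Fintype ι]
    [LocallyFiniteOrderTop ι] [LocallyFiniteOrderBot ι] [CommSemiring R] {f : ι → ι → R}
    (hf : ∀ k l, f k l = f l k) :
    ∑ k, ∑ l, f k l = ∑ k, f k k + 2 * ∑ k, ∑ l ∈ Finset.Ioi k, f k l := by
  have hrow : ∀ k, ∑ l, f k l = f k k + ∑ l ∈ {k}ᶜ, f l k := fun k => by
    rw [← Finset.sum_add_sum_compl {k}, Finset.sum_singleton]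
    exact congrArg _ (Finset.sum_congr rfl fun l _ => hf k l)
  simp only [hrow, Finset.sum_add_distrib, ← Finset.sum_sum_Ioi_add_eq_sum_sum_off_diag]
  simp only [Finset.mul_sum, two_mul, Finset.sum_add_distrib]
  congr 2
  exact Finset.sum_congr rfl fun k _ => Finset.sum_congr rfl fun l _ => hf l k

section Energy

variable {E : Type*} [NormedAddCommGroup E] [InnerProductSpace ℝ E] [FiniteDimensional ℝ E]
  [MeasurableSpace E] [BorelSpace E] (μ : Measure E) [μ.IsAddHaarMeasure]
  {Ω : Set E} {ι : Type*} [Fintype ι]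

theorem sum_sum_mul_setIntegral_nonneg (ho : IsOpen Ω) (hb : Bornology.IsBounded Ω)
    (α : ι → ℝ) {ρ U : ι → E → ℝ} (hUd : ∀ l, ContDiffOn ℝ 2 (U l) Ω)
    (hUc : ∀ l, ContinuousOn (U l) (closure Ω)) (hU0 : ∀ l, ∀ x ∈ frontier Ω, U l x = 0)
    (hlap : ∀ l, ∀ x ∈ Ω, Laplacian.laplacian (U l) x = -ρ l x)
    (hρ : ∀ k, IntegrableOn (ρ k) Ω μ) :
    0 ≤ ∑ k, ∑ l, α k * α l * ∫ x in Ω, ρ k x * U l x ∂μ := by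
  set u : E → ℝ := fun x => ∑ l, α l * U l x
  have hu : ContDiffOn ℝ 2 u Ω := ContDiffOn.sum fun l _ => contDiffOn_const.mul (hUd l)
  have hulap : ∀ x ∈ Ω, Laplacian.laplacian u x = -∑ k, α k * ρ k x := by
    intro x hx
    have hat : ∀ l, ContDiffAt ℝ 2 (U l) x := fun l => (hUd l).contDiffAt (ho.mem_nhds hx)
    rw [laplacian_finsetSum _ fun l _ => contDiffAt_const.mul (hat l), ← Finset.sum_neg_distrib]
    refine Finset.sum_congr rfl fun l _ => ?_
    rw [← mul_neg, ← hlap l x hx]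
    exact laplacian_smul (α l) (hat l)
  have hulapint : IntegrableOn (Laplacian.laplacian u) Ω μ :=
    IntegrableOn.congr_fun (integrable_finsetSum _ fun k _ => (hρ k).const_mul (α k)).neg
      (fun x hx => (hulap x hx).symm) ho.measurableSet
  have hρU : ∀ k l, IntegrableOn (fun x => ρ k x * U l x) Ω μ := fun k l => by
    obtain ⟨B, hB⟩ := hb.isCompact_closure.exists_bound_of_continuousOn (hUc l)
    exact (hρ k).mul_bdd ((hUd l).continuousOn.aestronglyMeasurable ho.measurableSet) (c := B)
      ((ae_restrict_mem ho.measurableSet).mono fun x hx => hB x (subset_closure hx))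
  have henergy : ∫ x in Ω, u x * Laplacian.laplacian u x ∂μ =
      -∑ k, ∑ l, α k * α l * ∫ x in Ω, ρ k x * U l x ∂μ := by
    have hexpand : ∀ x ∈ Ω, u x * Laplacian.laplacian u x =
        -∑ k, ∑ l, α k * α l * (ρ k x * U l x) := by
      intro x hx
      rw [hulap x hx, mul_neg, mul_comm, Finset.sum_mul_sum]
      simp only [mul_mul_mul_comm]
    rw [setIntegral_congr_fun ho.measurableSet hexpand, integral_neg,
      integral_finsetSum _ fun k _ => integrable_finsetSum _ fun l _ => (hρU k l).const_mul _]
    simp only [integral_finsetSum _ fun l _ => (hρU _ l).const_mul _, integral_const_mul]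
  have hnonpos := setIntegral_mul_laplacian_nonpos μ ho hb hu
    (continuousOn_finsetSum _ fun l _ => continuousOn_const.mul (hUc l))
    (fun x hx => Finset.sum_eq_zero fun l _ => by rw [hU0 l x hx, mul_zero]) hulapint
  linarith

end Energy

theorem neg_coulombEnergy_le {Ω : Set ℂ} (ho : IsOpen Ω) (hb : Bornology.IsBounded Ω)
    {g : ℂ → ℂ → ℝ} (hg : IsGreenRegularPart Ω g) {n : ℕ} (α : Fin n → ℝ) {x : Fin n → ℂ}
    {r : Fin n → ℝ} (hr : ∀ k, 0 < r k) (hball : ∀ k, Metric.closedBall (x k) (r k) ⊆ Ω)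
    (hsep : ∀ k l, k ≠ l → r k + r l ≤ ‖x k - x l‖) :
    -coulombEnergy Ω α x ≤ 1 / 2 * ∑ k, α k ^ 2 *
      (g (x k) (x k) - 1 / (2 * Real.pi) * Real.log (r k) + 3 / (8 * Real.pi)) := by
  have hx : ∀ k, x k ∈ Ω := fun k => hball k (Metric.mem_closedBall_self (hr k).le)
  set J : Fin n → Fin n → ℝ := fun k l =>
    ∫ y in Ω, smearedDensity (x k) (r k) y * smearedPotential g (x l) (r l) y
  have hJ : ∀ k l, J k l =
      ∫ y, smearedDensity (x k) (r k) y * smearedPotential g (x l) (r l) y := fun k l =>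
    setIntegral_smearedDensity_mul (hr k) (hball k) _
  have henergy : 0 ≤ ∑ k, ∑ l, α k * α l * J k l :=
    sum_sum_mul_setIntegral_nonneg volume ho hb α
      (fun l => contDiffOn_smearedPotential hg (hx l))
      (fun l => continuousOn_smearedPotential hg (hx l))
      (fun l y hy => smearedPotential_eq_zero ho hg (hr l) (hball l) hy)
      (fun l y hy => laplacian_smearedPotential ho hg (hr l) (hx l) hy)
      fun k => ((continuous_smearedDensity (x k) (r k)).continuousOn.integrableOn_compact
        hb.isCompact_closure).mono_set subset_closure
  have hmutual : ∀ k l, k ≠ l → J k l = greenFunction Ω (x k) (x l) := fun k l hkl =>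
    (hJ k l).trans (integral_smearedDensity_mul_smearedPotential ho hg hb (hr k) (hball k) (hr l)
      (hx l) (hsep k l hkl))
  have hself : ∑ k, α k * α k * J k k ≤ ∑ k, α k ^ 2 *
      (g (x k) (x k) - 1 / (2 * Real.pi) * Real.log (r k) + 3 / (8 * Real.pi)) := by
    refine Finset.sum_le_sum fun k _ => ?_
    rw [← sq, hJ]
    exact mul_le_mul_of_nonneg_left
      (integral_smearedDensity_mul_smearedPotential_self_le ho hg (hr k) (hball k)) (sq_nonneg _)
  have hsymm : ∀ k l, α k * α l * J k l = α l * α k * J l k := fun k l => by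
    rcases eq_or_ne k l with rfl | hkl
    · rfl
    · rw [hmutual k l hkl, hmutual l k hkl.symm, greenFunction_comm Ω (hx k) (hx l),
        mul_comm (α k)]
  have hoffdiag : ∑ k, ∑ l ∈ Finset.Ioi k, α k * α l * J k l = coulombEnergy Ω α x :=
    Finset.sum_congr rfl fun k _ => Finset.sum_congr rfl fun l hl => by
      rw [hmutual k l (Finset.mem_Ioi.1 hl).ne]
  rw [sum_sum_eq_sum_diag_add_two_mul_sum_Ioi hsymm, hoffdiag] at henergy
  linarith

theorem measurable_indicator_greenFunction {Ω : Set ℂ} (ho : IsOpen Ω)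
    (hb : Bornology.IsBounded Ω) :
    Measurable ((Ω ×ˢ Ω).indicator (Function.uncurry (greenFunction Ω))) := by
  by_cases h : ∃ g, IsGreenRegularPart Ω g
  · obtain ⟨g, hg⟩ := h
    have hm : MeasurableSet (Ω ×ˢ Ω) := ho.measurableSet.prod ho.measurableSet
    have heq : (Ω ×ˢ Ω).indicator (Function.uncurry (greenFunction Ω)) =
        (Ω ×ˢ Ω).indicator (fun p => 1 / (2 * Real.pi) * Real.log ‖p.1 - p.2‖⁻¹) +
          (Ω ×ˢ Ω).indicator (Function.uncurry g) := by
      rw [← Set.indicator_add']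
      exact Set.indicator_congr fun p hp => greenFunction_eq ho hb hg hp.1 hp.2
    rw [heq]
    refine (Measurable.indicator (by fun_prop) hm).add ?_
    classical
    rw [← Set.piecewise_eq_indicator]
    exact (hg.continuousOn_uncurry ho hb).measurable_piecewise continuousOn_const hm
  · have h0 : Function.uncurry (greenFunction Ω) = 0 := by
      funext p
      simp [Function.uncurry_def, greenFunction, h]
    rw [h0, Set.indicator_zero']
    exact measurable_zero

theorem exists_abs_greenFunction_add_sub_le {Ω : Set ℂ} (ho : IsOpen Ω)
    (hb : Bornology.IsBounded Ω) {δ : ℝ} (hδ : 0 < δ) :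
    ∃ L : ℝ, 0 ≤ L ∧ ∀ x y h : ℂ, Metric.closedBall x (2 * δ) ⊆ Ω →
      Metric.closedBall y (2 * δ) ⊆ Ω → ‖h‖ < δ →
      |greenFunction Ω (x + h) (y + h) - greenFunction Ω x y| ≤ L * ‖h‖ := by
  by_cases h : ∃ g, IsGreenRegularPart Ω g
  · obtain ⟨g, hg⟩ := h
    obtain ⟨L, hL, hgL⟩ := hg.exists_abs_sub_le ho hb hδ
    refine ⟨2 * L, by positivity, fun x y h hx hy hh => ?_⟩
    have hmem : ∀ z, Metric.closedBall z (2 * δ) ⊆ Ω → z ∈ Ω ∧ z + h ∈ Ω := fun z hz =>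
      ⟨hz (Metric.mem_closedBall_self (by positivity)),
        hz (mem_closedBall_iff_norm.2 (by rw [add_sub_cancel_left]; linarith))⟩
    rw [greenFunction_eq ho hb hg (hmem x hx).1 (hmem y hy).1,
      greenFunction_eq ho hb hg (hmem x hx).2 (hmem y hy).2, add_sub_add_right_eq_sub,
      add_sub_add_left_eq_sub]
    have := hgL x y (x + h) (y + h) hx hy (by simpa using hh) (by simpa using hh)
    simp only [add_sub_cancel_left] at this
    linarith
  · exact ⟨0, le_rfl, by simp [greenFunction, h]⟩

theorem exists_neg_coulombEnergy_le {Ω : Set ℂ} (ho : IsOpen Ω) (hb : Bornology.IsBounded Ω) :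
    ∃ B : ℝ, 0 ≤ B ∧ ∀ {n : ℕ} (α : Fin n → ℝ) (x : Fin n → ℂ) (r : Fin n → ℝ),
      (∀ k, 0 < r k) → (∀ k, r k ≤ 1) → (∀ k, Metric.closedBall (x k) (r k) ⊆ Ω) →
      (∀ k l, k ≠ l → r k + r l ≤ ‖x k - x l‖) →
      -coulombEnergy Ω α x ≤ 1 / 2 * ∑ k, α k ^ 2 * (B - 1 / (2 * Real.pi) * Real.log (r k)) := by
  by_cases h : ∃ g, IsGreenRegularPart Ω g
  · obtain ⟨g, hg⟩ := h
    refine ⟨max 0 (1 / (2 * Real.pi) * Real.log (Metric.diam (closure Ω)) + 3 / (8 * Real.pi)),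
      le_max_left _ _, fun α x r hr _ hball hsep =>
        (neg_coulombEnergy_le ho hb hg α hr hball hsep).trans ?_⟩
    gcongr with k _
    have hk : x k ∈ Ω := hball k (Metric.mem_closedBall_self (hr k).le)
    linarith [hg.le_log_diam ho hb (subset_closure hk) hk, le_max_right 0
      (1 / (2 * Real.pi) * Real.log (Metric.diam (closure Ω)) + 3 / (8 * Real.pi))]
  · refine ⟨0, le_rfl, fun α x r hr hr1 _ _ => ?_⟩
    have hself : ∀ k, 0 ≤ α k ^ 2 * (0 - 1 / (2 * Real.pi) * Real.log (r k)) := fun k => by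
      have hlog := Real.log_nonpos (hr k).le (hr1 k)
      have : 1 / (2 * Real.pi) * Real.log (r k) ≤ 0 :=
        mul_nonpos_of_nonneg_of_nonpos (by positivity) hlog
      exact mul_nonneg (sq_nonneg _) (by linarith)
    simp only [coulombEnergy, greenFunction, h, dite_false, mul_zero, Finset.sum_const_zero,
      neg_zero]
    exact mul_nonneg (by norm_num) (Finset.sum_nonneg fun k _ => hself k)

section NearestCount

variable {E : Type*} [NormedAddCommGroup E] [NormedSpace ℝ E]

theorem one_le_norm_sub_normalize {u v : E} (hu : u ≠ 0) (huv : ‖u‖ ≤ ‖v‖)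
    (hv : ‖v‖ ≤ ‖v - u‖) : 1 ≤ ‖‖v‖⁻¹ • v - ‖u‖⁻¹ • u‖ := by
  have hu0 : 0 < ‖u‖ := norm_pos_iff.2 hu
  have hv0 : 0 < ‖v‖ := hu0.trans_le huv
  have hdecomp : v - u = ‖u‖ • (‖v‖⁻¹ • v - ‖u‖⁻¹ • u) + (‖v‖ - ‖u‖) • ‖v‖⁻¹ • v := by
    rw [smul_sub, sub_smul, smul_inv_smul₀ hu0.ne', smul_inv_smul₀ hv0.ne']
    abel
  have hnorm : ‖v - u‖ ≤ ‖u‖ * ‖‖v‖⁻¹ • v - ‖u‖⁻¹ • u‖ + (‖v‖ - ‖u‖) := by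
    conv_lhs => rw [hdecomp]
    refine (norm_add_le _ _).trans_eq ?_
    rw [norm_smul, norm_norm, norm_smul, Real.norm_of_nonneg (sub_nonneg.2 huv), norm_smul,
      norm_inv, norm_norm, inv_mul_cancel₀ hv0.ne', mul_one]
  refine le_of_mul_le_mul_left ?_ hu0
  linarith

variable [FiniteDimensional ℝ E]

theorem card_le_multiplicity_of_dist_le {ι : Type*} (A : Finset ι) {y : ι → E} {z : E}
    (hne : ∀ k ∈ A, y k ≠ z)
    (hA : ∀ k ∈ A, ∀ j ∈ A, j ≠ k → dist (y k) z ≤ dist (y k) (y j)) :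
    A.card ≤ Besicovitch.multiplicity E := by
  classical
  set φ : ι → E := fun k => ‖y k - z‖⁻¹ • (y k - z)
  have hsep : ∀ j ∈ A, ∀ k ∈ A, j ≠ k → 1 ≤ ‖φ j - φ k‖ := by
    intro j hj k hk hjk
    have hle : ∀ i ∈ A, ∀ i' ∈ A, i' ≠ i → ‖y i - z‖ ≤ ‖(y i - z) - (y i' - z)‖ :=
      fun i hi i' hi' h => by
        rw [sub_sub_sub_cancel_right, ← dist_eq_norm, ← dist_eq_norm]
        exact hA i hi i' hi' h
    rcases le_total ‖y j - z‖ ‖y k - z‖ with h | h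
    · rw [norm_sub_rev]
      exact one_le_norm_sub_normalize (sub_ne_zero.2 (hne j hj)) h (hle k hk j hj hjk)
    · exact one_le_norm_sub_normalize (sub_ne_zero.2 (hne k hk)) h (hle j hj k hk hjk.symm)
  have hinj : Set.InjOn φ A := fun j hj k hk hjk => by
    by_contra h
    have := hsep j hj k hk h
    rw [hjk, sub_self, norm_zero] at this
    linarith
  rw [← Finset.card_image_of_injOn hinj]
  refine Besicovitch.card_le_multiplicity (fun c hc => ?_) fun c hc d hd hcd => ?_
  · obtain ⟨k, hk, rfl⟩ := Finset.mem_image.1 hc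
    have : ‖y k - z‖ ≠ 0 := norm_ne_zero_iff.2 (sub_ne_zero.2 (hne k hk))
    rw [norm_smul, norm_inv, norm_norm, inv_mul_cancel₀ this]
    exact one_le_two
  · obtain ⟨j, hj, rfl⟩ := Finset.mem_image.1 hc
    obtain ⟨k, hk, rfl⟩ := Finset.mem_image.1 hd
    exact hsep j hj k hk fun h => hcd (by rw [h])

end NearestCount

/-- The distance from `x k` to the nearest other point, or `δ` if that is smaller. -/
noncomputable def nearestDist {X ι : Type*} [Dist X] [DecidableEq ι] (δ : ℝ) (x : ι → X)
    (k : ι) : ℝ :=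
  ⨅ l, if l = k then δ else dist (x k) (x l)

section NearestDist

variable {X ι : Type*} [PseudoMetricSpace X] [DecidableEq ι] [Finite ι] {δ : ℝ} {x : ι → X}
  {k : ι}

theorem nearestDist_le : nearestDist δ x k ≤ δ :=
  (ciInf_le (Set.finite_range _).bddBelow k).trans (by simp)

theorem nearestDist_le_dist {l : ι} (h : l ≠ k) : nearestDist δ x k ≤ dist (x k) (x l) :=
  (ciInf_le (Set.finite_range _).bddBelow l).trans (by simp [h])

omit [Finite ι] in
theorem le_nearestDist {c : ℝ} (h : c ≤ δ) (h' : ∀ l, l ≠ k → c ≤ dist (x k) (x l)) :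
    c ≤ nearestDist δ x k := by
  have : Nonempty ι := ⟨k⟩
  refine le_ciInf fun l => ?_
  split_ifs with hl
  · exact h
  · exact h' l hl

omit [Finite ι] in
theorem nearestDist_nonneg (hδ : 0 ≤ δ) : 0 ≤ nearestDist δ x k :=
  le_nearestDist hδ fun _ _ => dist_nonneg

theorem nearestDist_pos {X : Type*} [MetricSpace X] {x : ι → X} (hδ : 0 < δ)
    (hx : Function.Injective x) : 0 < nearestDist δ x k := by
  have : Nonempty ι := ⟨k⟩
  obtain ⟨l, hl⟩ := exists_eq_ciInf_of_finite
    (f := fun l => if l = k then δ else dist (x k) (x l))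
  rw [nearestDist, ← hl]
  split_ifs with h
  · exact hδ
  · exact dist_pos.2 fun he => h (hx he).symm

theorem nearestDist_castSucc {n : ℕ} {x : Fin (n + 1) → X} {k : Fin n} :
    nearestDist δ x k.castSucc =
      min (nearestDist δ (fun j => x j.castSucc) k) (dist (x (Fin.last n)) (x k.castSucc)) := by
  rw [dist_comm]
  apply le_antisymm
  · refine le_min (le_nearestDist nearestDist_le fun l hl => ?_)
      (nearestDist_le_dist (Fin.castSucc_lt_last k).ne')
    exact nearestDist_le_dist fun h => hl (Fin.castSucc_injective n h)
  · refine le_nearestDist ((min_le_left _ _).trans nearestDist_le) fun l => ?_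
    induction l using Fin.lastCases with
    | last => exact fun _ => min_le_right _ _
    | cast l =>
      exact fun hl => (min_le_left _ _).trans (nearestDist_le_dist fun h => hl (by rw [h]))

theorem nearestDist_last {n : ℕ} {x : Fin (n + 1) → X} {k₀ : Fin n}
    (hk₀ : ∀ k : Fin n, dist (x (Fin.last n)) (x k₀.castSucc) ≤
      dist (x (Fin.last n)) (x k.castSucc)) :
    nearestDist δ x (Fin.last n) = min δ (dist (x (Fin.last n)) (x k₀.castSucc)) := by
  refine le_antisymm (le_min nearestDist_le (nearestDist_le_dist (Fin.castSucc_lt_last k₀).ne))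
    (le_nearestDist (min_le_left _ _) fun l => ?_)
  induction l using Fin.lastCases with
  | last => exact fun h => (h rfl).elim
  | cast l => exact fun _ => (min_le_right _ _).trans (hk₀ l)

end NearestDist

/-- The product of the nearest neighbour distances to the power `-a`, which bounds the Boltzmann
factor. Since `0 ^ (-a) = 0` for `a ≠ 0`, it vanishes when two points coincide. -/
noncomputable def nearestWeight {X ι : Type*} [Dist X] [DecidableEq ι] [Fintype ι] (a δ : ℝ)
    (x : ι → X) : ℝ :=
  ∏ k, nearestDist δ x k ^ (-a)

/-- A bound, up to a constant, for the factor by which `nearestWeight a δ x` grows when the point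
`z` is added. The cut-off `ε` at which the singularities `dist z (x k) ^ (-a)` are replaced by
`ε ^ (-a)` is free. -/
noncomputable def nearestKernel {X ι : Type*} [PseudoMetricSpace X] [DecidableEq ι] [Fintype ι]
    (a δ ε : ℝ) (x : ι → X) (z : X) : ENNReal :=
  ENNReal.ofReal (δ ^ (-a) + ε ^ (-a)) +
    ((∑ k, (Metric.ball (x k) ε).indicator
      (fun z => ENNReal.ofReal (dist z (x k) ^ (-a))) z) +
    ∑ k, (Metric.ball (x k) (nearestDist δ x k)).indicator
      (fun z => ENNReal.ofReal (nearestDist δ x k ^ a * dist z (x k) ^ (-(2 * a)))) z)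

section NearestWeight

variable {X ι : Type*} [DecidableEq ι] [Fintype ι] {a δ ε : ℝ}

theorem nearestWeight_nonneg [PseudoMetricSpace X] {x : ι → X} (hδ : 0 ≤ δ) :
    0 ≤ nearestWeight a δ x :=
  Finset.prod_nonneg fun _ _ => Real.rpow_nonneg (nearestDist_nonneg hδ) _

theorem nearestWeight_eq_zero [PseudoMetricSpace X] {x : ι → X} (hδ : 0 ≤ δ) (ha : a ≠ 0)
    (hx : ¬Function.Injective x) : nearestWeight a δ x = 0 := by
  obtain ⟨k, l, hkl, hne⟩ := Function.not_injective_iff.1 hx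
  have hzero : nearestDist δ x k = 0 :=
    le_antisymm ((nearestDist_le_dist hne.symm).trans_eq (by rw [hkl, dist_self]))
      (nearestDist_nonneg hδ)
  refine Finset.prod_eq_zero (Finset.mem_univ k) ?_
  rw [hzero, Real.zero_rpow (neg_ne_zero.2 ha)]

theorem nearestWeight_eq_castSucc_mul [MetricSpace X] {n : ℕ} {x : Fin (n + 1) → X}
    (hδ : 0 < δ) (hx : Function.Injective x) :
    nearestWeight a δ x = nearestWeight a δ (fun k : Fin n => x k.castSucc) *
      (∏ k : Fin n, max 1 (nearestDist δ (fun k : Fin n => x k.castSucc) k /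
        dist (x (Fin.last n)) (x k.castSucc)) ^ a) * nearestDist δ x (Fin.last n) ^ (-a) := by
  rw [nearestWeight, Fin.prod_univ_castSucc, nearestWeight, ← Finset.prod_mul_distrib]
  congr 1
  refine Finset.prod_congr rfl fun k _ => ?_
  rw [nearestDist_castSucc]
  set r := nearestDist δ (fun k : Fin n => x k.castSucc) k
  set d := dist (x (Fin.last n)) (x k.castSucc)
  have hr : 0 < r := nearestDist_pos hδ (hx.comp (Fin.castSucc_injective n))
  have hd : 0 < d := dist_pos.2 fun h => (Fin.castSucc_lt_last k).ne' (hx h)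
  have hM : 0 < max 1 (r / d) := by positivity
  have hmin : min r d = r / max 1 (r / d) := by
    rcases le_total r d with h | h
    · rw [min_eq_left h, max_eq_left ((div_le_one hd).2 h), div_one]
    · rw [min_eq_right h, max_eq_right ((one_le_div hd).2 h), div_div_cancel₀ hr.ne']
  rw [hmin, Real.div_rpow hr.le hM.le, Real.rpow_neg hM.le, div_inv_eq_mul]

/-- The radius `r` may exceed `2 d` only at the nearest point `y k₀`, and exceeds `d` for boundedly
many points. -/
theorem prod_erase_max_one_div_rpow_le {E : Type*} [NormedAddCommGroup E] [NormedSpace ℝ E]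
    [FiniteDimensional ℝ E] (ha : 0 ≤ a) (ha1 : a ≤ 1) {y : ι → E} {z : E} {k₀ : ι}
    (hz : ∀ k, y k ≠ z) (hk₀ : ∀ k, dist z (y k₀) ≤ dist z (y k)) :
    ∏ k ∈ Finset.univ.erase k₀, max 1 (nearestDist δ y k / dist z (y k)) ^ a ≤
      2 ^ Besicovitch.multiplicity E := by
  have hd : ∀ k, 0 < dist z (y k) := fun k => dist_pos.2 (hz k).symm
  set A : Finset ι := {k ∈ Finset.univ.erase k₀ | dist z (y k) < nearestDist δ y k}
  have hcard : A.card ≤ Besicovitch.multiplicity E := by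
    refine card_le_multiplicity_of_dist_le A (fun k _ => hz k) fun k hk j _ hjk => ?_
    rw [dist_comm]
    exact (Finset.mem_filter.1 hk).2.le.trans (nearestDist_le_dist hjk)
  have hfactor : ∀ k ∈ Finset.univ.erase k₀, max 1 (nearestDist δ y k / dist z (y k)) ^ a ≤
      if dist z (y k) < nearestDist δ y k then 2 else 1 := by
    intro k hk
    split_ifs with h
    · have hratio : nearestDist δ y k / dist z (y k) ≤ 2 := by
        rw [div_le_iff₀ (hd k)]
        have hnear := nearestDist_le_dist (δ := δ) (x := y) (Finset.ne_of_mem_erase hk).symm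
        linarith [dist_triangle_left (y k) (y k₀) z, hk₀ k]
      calc max 1 (nearestDist δ y k / dist z (y k)) ^ a ≤ 2 ^ a :=
            Real.rpow_le_rpow (by positivity) (max_le one_le_two hratio) ha
        _ ≤ 2 ^ (1 : ℝ) := Real.rpow_le_rpow_of_exponent_le one_le_two ha1
        _ = 2 := Real.rpow_one 2
    · rw [max_eq_left ((div_le_one (hd k)).2 (not_lt.1 h)), Real.one_rpow]
  calc ∏ k ∈ Finset.univ.erase k₀, max 1 (nearestDist δ y k / dist z (y k)) ^ a
      ≤ ∏ k ∈ Finset.univ.erase k₀, if dist z (y k) < nearestDist δ y k then (2 : ℝ) else 1 :=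
        Finset.prod_le_prod (fun k _ => by positivity) hfactor
    _ = 2 ^ A.card := by rw [Finset.prod_ite, Finset.prod_const, Finset.prod_const_one, mul_one]
    _ ≤ 2 ^ Besicovitch.multiplicity E := pow_le_pow_right₀ one_le_two hcard

theorem ofReal_max_one_div_rpow_mul_le_nearestKernel [MetricSpace X] (ha : 0 ≤ a) (hδ : 0 < δ)
    (hε : 0 < ε) {y : ι → X} {z : X} {k : ι} (hz : y k ≠ z) :
    ENNReal.ofReal (max 1 (nearestDist δ y k / dist z (y k)) ^ a * min δ (dist z (y k)) ^ (-a)) ≤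
      nearestKernel a δ ε y z := by
  set r := nearestDist δ y k
  set d := dist z (y k)
  have hd : 0 < d := dist_pos.2 hz.symm
  have hr : 0 ≤ r := nearestDist_nonneg hδ.le
  rcases lt_or_ge d r with hdr | hrd
  · have hval : max 1 (r / d) ^ a * min δ d ^ (-a) = r ^ a * d ^ (-(2 * a)) := by
      rw [min_eq_right (hdr.le.trans nearestDist_le), max_eq_right ((one_le_div hd).2 hdr.le),
        Real.div_rpow hr hd.le, div_eq_mul_inv, mul_assoc, ← Real.rpow_neg hd.le,
        ← Real.rpow_add hd, show -a + -a = -(2 * a) by ring]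
    have hterm := Finset.single_le_sum_of_canonicallyOrdered (Finset.mem_univ k) (f := fun l =>
      (Metric.ball (y l) (nearestDist δ y l)).indicator
        (fun z => ENNReal.ofReal (nearestDist δ y l ^ a * dist z (y l) ^ (-(2 * a)))) z)
    rw [Set.indicator_of_mem (Metric.mem_ball.2 hdr)] at hterm
    rw [hval]
    exact hterm.trans (le_add_self.trans le_add_self)
  rw [max_eq_left ((div_le_one hd).2 hrd), Real.one_rpow, one_mul]
  rcases le_total δ d with hδd | hdδ
  · rw [min_eq_left hδd]
    exact (ENNReal.ofReal_le_ofReal (le_add_of_nonneg_right (by positivity))).trans le_self_add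
  rw [min_eq_right hdδ]
  rcases lt_or_ge d ε with hdε | hεd
  · have hterm := Finset.single_le_sum_of_canonicallyOrdered (Finset.mem_univ k) (f := fun l =>
      (Metric.ball (y l) ε).indicator (fun z => ENNReal.ofReal (dist z (y l) ^ (-a))) z)
    rw [Set.indicator_of_mem (Metric.mem_ball.2 hdε)] at hterm
    exact hterm.trans (le_self_add.trans le_add_self)
  · have hcut := Real.rpow_le_rpow_of_nonpos hε hεd (neg_nonpos.2 ha)
    exact (ENNReal.ofReal_le_ofReal (hcut.trans (le_add_of_nonneg_left (by positivity)))).trans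
      le_self_add

theorem ofReal_nearestWeight_le {E : Type*} [NormedAddCommGroup E] [NormedSpace ℝ E]
    [FiniteDimensional ℝ E] (ha : 0 ≤ a) (ha1 : a ≤ 1) (hδ : 0 < δ) (hε : 0 < ε) {n : ℕ}
    [NeZero n] (x : Fin (n + 1) → E) :
    ENNReal.ofReal (nearestWeight a δ x) ≤ 2 ^ Besicovitch.multiplicity E *
      (ENNReal.ofReal (nearestWeight a δ fun k : Fin n => x k.castSucc) *
        nearestKernel a δ ε (fun k : Fin n => x k.castSucc) (x (Fin.last n))) := by
  by_cases hx : Function.Injective x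
  · obtain ⟨k₀, hk₀⟩ := Finite.exists_min fun k : Fin n => dist (x (Fin.last n)) (x k.castSucc)
    set y : Fin n → E := fun k => x k.castSucc
    set z := x (Fin.last n)
    have hz : ∀ k, y k ≠ z := fun k h => (Fin.castSucc_lt_last k).ne (hx h)
    have hw : 0 ≤ nearestWeight a δ y := nearestWeight_nonneg hδ.le
    have hothers := prod_erase_max_one_div_rpow_le (δ := δ) ha ha1 hz hk₀
    have hweight : nearestWeight a δ x ≤ 2 ^ Besicovitch.multiplicity E * (nearestWeight a δ y *
        (max 1 (nearestDist δ y k₀ / dist z (y k₀)) ^ a * min δ (dist z (y k₀)) ^ (-a))) := by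
      rw [nearestWeight_eq_castSucc_mul hδ hx, nearestDist_last hk₀,
        ← Finset.mul_prod_erase _ _ (Finset.mem_univ k₀)]
      calc _ = (∏ k ∈ Finset.univ.erase k₀, max 1 (nearestDist δ y k / dist z (y k)) ^ a) *
            (nearestWeight a δ y * (max 1 (nearestDist δ y k₀ / dist z (y k₀)) ^ a *
              min δ (dist z (y k₀)) ^ (-a))) := by ring
        _ ≤ _ := by gcongr
    refine (ENNReal.ofReal_le_ofReal hweight).trans ?_
    rw [ENNReal.ofReal_mul (by positivity), ENNReal.ofReal_mul hw,
      ENNReal.ofReal_pow zero_le_two, ENNReal.ofReal_ofNat]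
    gcongr
    exact ofReal_max_one_div_rpow_mul_le_nearestKernel ha hδ hε (hz k₀)
  rcases eq_or_ne a 0 with rfl | ha0
  · have hker : (1 : ENNReal) ≤ nearestKernel 0 δ ε (fun k : Fin n => x k.castSucc)
        (x (Fin.last n)) :=
      (ENNReal.one_le_ofReal.2 (by norm_num)).trans le_self_add
    simpa [nearestWeight] using one_le_mul (one_le_pow₀ one_le_two) hker
  · rw [nearestWeight_eq_zero hδ.le ha0 hx, ENNReal.ofReal_zero]
    exact zero_le

end NearestWeight

section FiniteDimensional

variable {E : Type*} [NormedAddCommGroup E] [NormedSpace ℝ E] [FiniteDimensional ℝ E]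
  [Nontrivial E]

theorem sum_nearestDist_pow_finrank_le {ι : Type*} [Fintype ι] [DecidableEq ι] {δ D : ℝ}
    (hδ : 0 ≤ δ) (hD : 0 ≤ D) {x : ι → E} (hx : ∀ k, x k ∈ Metric.ball 0 D) :
    ∑ k, nearestDist δ x k ^ Module.finrank ℝ E ≤ (2 * D + δ) ^ Module.finrank ℝ E := by
  borelize E
  set d := Module.finrank ℝ E
  let μ : Measure E := Measure.addHaar
  have hr : ∀ k, 0 ≤ nearestDist δ x k / 2 := fun k =>
    div_nonneg (nearestDist_nonneg hδ) zero_le_two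
  have hdisj : Pairwise
      (Function.onFun Disjoint fun k => Metric.ball (x k) (nearestDist δ x k / 2)) := by
    intro k l hkl
    have hk := nearestDist_le_dist (δ := δ) (x := x) hkl.symm
    have hl := nearestDist_le_dist (δ := δ) (x := x) hkl
    rw [dist_comm] at hl
    exact Metric.ball_disjoint_ball (by linarith)
  have hsub : (⋃ k, Metric.ball (x k) (nearestDist δ x k / 2)) ⊆ Metric.ball 0 (D + δ / 2) := by
    refine Set.iUnion_subset fun k => Metric.ball_subset_ball' ?_
    linarith [nearestDist_le (δ := δ) (x := x) (k := k), Metric.mem_ball.1 (hx k)]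
  have hvol := measure_mono (μ := μ) hsub
  rw [measure_iUnion hdisj fun k => measurableSet_ball, tsum_fintype,
    μ.addHaar_ball _ (by positivity)] at hvol
  simp_rw [fun k => μ.addHaar_ball (x k) (hr k)] at hvol
  rw [← Finset.sum_mul, ENNReal.mul_le_mul_iff_left
    (Metric.measure_ball_pos μ 0 one_pos).ne' measure_ball_lt_top.ne,
    ← ENNReal.ofReal_sum_of_nonneg fun k _ => pow_nonneg (hr k) _,
    ENNReal.ofReal_le_ofReal_iff (by positivity)] at hvol
  calc ∑ k, nearestDist δ x k ^ d = 2 ^ d * ∑ k, (nearestDist δ x k / 2) ^ d := by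
        simp_rw [Finset.mul_sum, ← mul_pow, mul_div_cancel₀ _ (two_ne_zero' ℝ)]
    _ ≤ 2 ^ d * (D + δ / 2) ^ d := by gcongr
    _ = (2 * D + δ) ^ d := by rw [← mul_pow]; ring

theorem finrank_sub_one_pow_smul_rpow {b y : ℝ} (hy : 0 < y) :
    y ^ (Module.finrank ℝ E - 1) • y ^ (-b) = y ^ ((Module.finrank ℝ E : ℝ) - 1 - b) := by
  rw [smul_eq_mul, ← Real.rpow_natCast, ← Real.rpow_add hy, Nat.cast_pred Module.finrank_pos,
    ← sub_eq_add_neg]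

variable [MeasurableSpace E] [BorelSpace E] (μ : Measure E) [μ.IsAddHaarMeasure] {b t : ℝ}

theorem integrableOn_ball_norm_rpow (hb : b < Module.finrank ℝ E) :
    IntegrableOn (fun z : E => ‖z‖ ^ (-b)) (Metric.ball 0 t) μ := by
  have hint : IntegrableOn (fun y : ℝ => y ^ ((Module.finrank ℝ E : ℝ) - 1 - b))
      (Set.Ioo 0 t) := by
    rw [← integrableOn_Ioc_iff_integrableOn_Ioo]
    exact (intervalIntegral.intervalIntegrable_rpow' (by linarith)).1
  exact (integrableOn_fun_norm_addHaar μ (f := fun y => y ^ (-b))).2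
    (hint.congr_fun (fun y hy => (finrank_sub_one_pow_smul_rpow hy.1).symm) measurableSet_Ioo)

theorem setIntegral_ball_norm_rpow (ht : 0 ≤ t) (hb : b < Module.finrank ℝ E) :
    ∫ z in Metric.ball (0 : E) t, ‖z‖ ^ (-b) ∂μ =
      Module.finrank ℝ E * μ.real (Metric.ball 0 1) *
        (t ^ (Module.finrank ℝ E - b) / (Module.finrank ℝ E - b)) := by
  set d := Module.finrank ℝ E
  have hradial : (Metric.ball (0 : E) t).indicator (fun z => ‖z‖ ^ (-b)) =
      fun z => (Set.Iio t).indicator (fun y => y ^ (-b)) ‖z‖ := by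
    ext z
    simp [Set.indicator]
  have hsmul : (fun y : ℝ => y ^ (d - 1) • (Set.Iio t).indicator (fun y => y ^ (-b)) y) =
      (Set.Iio t).indicator fun y => y ^ (d - 1) • y ^ (-b) :=
    (Set.indicator_smul _ _ _).symm
  rw [← integral_indicator measurableSet_ball, hradial, integral_fun_norm_addHaar, hsmul,
    setIntegral_indicator measurableSet_Iio, Set.Ioi_inter_Iio,
    setIntegral_congr_fun measurableSet_Ioo fun y hy => finrank_sub_one_pow_smul_rpow hy.1,
    ← integral_Ioc_eq_integral_Ioo, ← intervalIntegral.integral_of_le ht,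
    integral_rpow (Or.inl (by linarith)), show (d : ℝ) - 1 - b + 1 = d - b by ring,
    Real.zero_rpow (by linarith), sub_zero, nsmul_eq_mul, smul_eq_mul, mul_assoc]

theorem lintegral_ball_dist_rpow (c : E) (ht : 0 ≤ t) (hb : b < Module.finrank ℝ E) :
    ∫⁻ z in Metric.ball c t, ENNReal.ofReal (dist z c ^ (-b)) ∂μ =
      ENNReal.ofReal (Module.finrank ℝ E * μ.real (Metric.ball 0 1) *
        (t ^ (Module.finrank ℝ E - b) / (Module.finrank ℝ E - b))) := by
  have hball : (fun z : E => z - c) ⁻¹' Metric.ball 0 t = Metric.ball c t := by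
    ext z
    simp [dist_eq_norm]
  calc ∫⁻ z in Metric.ball c t, ENNReal.ofReal (dist z c ^ (-b)) ∂μ
      = ∫⁻ z in Metric.ball 0 t, ENNReal.ofReal (‖z‖ ^ (-b)) ∂μ := by
        simp_rw [dist_eq_norm]
        rw [← hball]
        exact (measurePreserving_sub_right μ c).setLIntegral_comp_preimage_emb
          (measurableEmbedding_subRight c) (fun z => ENNReal.ofReal (‖z‖ ^ (-b))) _
    _ = ENNReal.ofReal (∫ z in Metric.ball 0 t, ‖z‖ ^ (-b) ∂μ) :=
        (ofReal_integral_eq_lintegral_ofReal (integrableOn_ball_norm_rpow μ hb)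
          (ae_of_all _ fun z => Real.rpow_nonneg (norm_nonneg z) _)).symm
    _ = _ := by rw [setIntegral_ball_norm_rpow μ ht hb]

end FiniteDimensional

theorem lintegral_ball_dist_rpow_complex (c : ℂ) {t b : ℝ} (ht : 0 ≤ t) (hb : b < 2) :
    ∫⁻ z in Metric.ball c t, ENNReal.ofReal (dist z c ^ (-b)) =
      ENNReal.ofReal (2 * Real.pi / (2 - b) * t ^ (2 - b)) := by
  have hpi : volume.real (Metric.ball (0 : ℂ) 1) = Real.pi := by
    simp [Measure.real, Complex.volume_ball]
  rw [lintegral_ball_dist_rpow volume c ht (by simpa using hb), hpi, Complex.finrank_real_complex,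
    Nat.cast_ofNat, mul_div_left_comm, mul_comm]

section KernelIntegral

variable {ι : Type*} [Fintype ι] [DecidableEq ι] {a δ ε D : ℝ}

theorem setLIntegral_indicator_ball_le (S : Set ℂ) (c : ℂ) {s t b : ℝ} (hs : 0 ≤ s) (ht : 0 ≤ t)
    (hb : b < 2) :
    ∫⁻ z in S, (Metric.ball c t).indicator (fun z => ENNReal.ofReal (s * dist z c ^ (-b))) z ≤
      ENNReal.ofReal (s * (2 * Real.pi / (2 - b) * t ^ (2 - b))) := by
  refine (setLIntegral_le_lintegral _ _).trans_eq ?_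
  rw [lintegral_indicator measurableSet_ball, ENNReal.ofReal_mul hs,
    ← lintegral_ball_dist_rpow_complex c ht hb]
  simp_rw [ENNReal.ofReal_mul hs]
  exact lintegral_const_mul' _ _ ENNReal.ofReal_ne_top

theorem setLIntegral_nearestKernel (x : ι → ℂ) (S : Set ℂ) :
    ∫⁻ z in S, nearestKernel a δ ε x z =
      ENNReal.ofReal (δ ^ (-a) + ε ^ (-a)) * volume S +
        ((∑ k, ∫⁻ z in S, (Metric.ball (x k) ε).indicator
          (fun z => ENNReal.ofReal (dist z (x k) ^ (-a))) z) +
        ∑ k, ∫⁻ z in S, (Metric.ball (x k) (nearestDist δ x k)).indicator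
          (fun z => ENNReal.ofReal (nearestDist δ x k ^ a * dist z (x k) ^ (-(2 * a)))) z) := by
  have hmeas : ∀ (k : ι) (t : ℝ) (f : ℂ → ℝ), Measurable f →
      Measurable ((Metric.ball (x k) t).indicator fun z => ENNReal.ofReal (f z)) :=
    fun k t f hf => hf.ennreal_ofReal.indicator measurableSet_ball
  simp only [nearestKernel]
  rw [lintegral_add_left measurable_const, lintegral_add_left
      (Finset.measurable_fun_sum _ fun k _ => hmeas k _ _ (by fun_prop)),
    lintegral_finsetSum _ fun k _ => hmeas k _ _ (by fun_prop),
    lintegral_finsetSum _ fun k _ => hmeas k _ _ (by fun_prop), setLIntegral_const]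

theorem setLIntegral_nearestKernel_le (ha : 0 ≤ a) (ha1 : a < 1) (hδ : 0 ≤ δ) (hε : 0 ≤ ε)
    (hD : 0 ≤ D) (x : ι → ℂ) {S : Set ℂ} (hS : S ⊆ Metric.ball 0 D) :
    ∫⁻ z in S, nearestKernel a δ ε x z ≤
      ENNReal.ofReal ((δ ^ (-a) + ε ^ (-a)) * (Real.pi * D ^ 2) +
        (Fintype.card ι * (2 * Real.pi / (2 - a) * ε ^ (2 - a)) +
        Real.pi / (1 - a) * ∑ k, nearestDist δ x k ^ (2 - a))) := by
  have : 0 < 1 - a := sub_pos.2 ha1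
  have : 0 < 2 - a := by linarith
  have hr : ∀ k, 0 ≤ nearestDist δ x k := fun k => nearestDist_nonneg hδ
  have hvol : volume S ≤ ENNReal.ofReal (Real.pi * D ^ 2) := by
    refine (measure_mono hS).trans_eq ?_
    rw [Complex.volume_ball, ENNReal.ofReal_mul Real.pi_nonneg, ENNReal.ofReal_pow hD, mul_comm,
      ← NNReal.coe_real_pi, ENNReal.ofReal_coe_nnreal]
  have hcutoff : ∀ k, ∫⁻ z in S, (Metric.ball (x k) ε).indicator
      (fun z => ENNReal.ofReal (dist z (x k) ^ (-a))) z ≤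
      ENNReal.ofReal (2 * Real.pi / (2 - a) * ε ^ (2 - a)) := fun k => by
    simpa only [one_mul] using
      setLIntegral_indicator_ball_le S (x k) zero_le_one hε (by linarith : a < 2)
  have hnear : ∀ k, ∫⁻ z in S, (Metric.ball (x k) (nearestDist δ x k)).indicator
      (fun z => ENNReal.ofReal (nearestDist δ x k ^ a * dist z (x k) ^ (-(2 * a)))) z ≤
      ENNReal.ofReal (Real.pi / (1 - a) * nearestDist δ x k ^ (2 - a)) := fun k => by
    refine (setLIntegral_indicator_ball_le S (x k) (Real.rpow_nonneg (hr k) a) (hr k)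
      (by linarith : 2 * a < 2)).trans_eq ?_
    rw [show 2 - a = a + (2 - 2 * a) by ring, Real.rpow_add_of_nonneg (hr k) ha (by linarith),
      show 2 - 2 * a = 2 * (1 - a) by ring, mul_div_mul_left _ _ two_ne_zero]
    ring_nf
  have hnonneg : ∀ k ∈ Finset.univ, 0 ≤ Real.pi / (1 - a) * nearestDist δ x k ^ (2 - a) :=
    fun k _ => mul_nonneg (by positivity) (Real.rpow_nonneg (hr k) _)
  rw [setLIntegral_nearestKernel, Finset.mul_sum,
    ENNReal.ofReal_add (p := _ * (Real.pi * D ^ 2)) (by positivity)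
      (add_nonneg (by positivity) (Finset.sum_nonneg hnonneg)),
    ENNReal.ofReal_add (by positivity) (Finset.sum_nonneg hnonneg),
    ENNReal.ofReal_mul (p := δ ^ (-a) + ε ^ (-a)) (by positivity),
    ENNReal.ofReal_sum_of_nonneg hnonneg, ENNReal.ofReal_mul (Nat.cast_nonneg _),
    ENNReal.ofReal_natCast, ← nsmul_eq_mul (Fintype.card ι), ← Finset.card_univ,
    ← Finset.sum_const]
  gcongr with k _ k _
  · exact hcutoff k
  · exact hnear k

theorem sum_nearestDist_rpow_le (ha : 0 ≤ a) (ha1 : a ≤ 2) (hδ : 0 ≤ δ) (hε : 0 < ε) (hD : 0 ≤ D)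
    {x : ι → ℂ} (hx : ∀ k, x k ∈ Metric.ball 0 D) :
    ∑ k, nearestDist δ x k ^ (2 - a) ≤
      ε ^ (-a) * (2 * D + δ) ^ 2 + Fintype.card ι * ε ^ (2 - a) := by
  have hterm : ∀ k, nearestDist δ x k ^ (2 - a) ≤
      ε ^ (-a) * nearestDist δ x k ^ 2 + ε ^ (2 - a) := by
    intro k
    have hr := nearestDist_nonneg hδ (x := x) (k := k)
    rcases le_total (nearestDist δ x k) ε with h | h
    · exact (Real.rpow_le_rpow hr h (by linarith)).trans
        (le_add_of_nonneg_left (by positivity))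
    · have hr0 : 0 < nearestDist δ x k := hε.trans_le h
      refine le_trans ?_ (le_add_of_nonneg_right (by positivity))
      rw [sub_eq_neg_add, Real.rpow_add hr0, Real.rpow_two]
      gcongr ?_ * _
      exact Real.rpow_le_rpow_of_nonpos hε h (by linarith)
  have hpack := sum_nearestDist_pow_finrank_le hδ hD hx
  rw [Complex.finrank_real_complex] at hpack
  calc ∑ k, nearestDist δ x k ^ (2 - a)
      ≤ ∑ k, (ε ^ (-a) * nearestDist δ x k ^ 2 + ε ^ (2 - a)) :=
        Finset.sum_le_sum fun k _ => hterm k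
    _ = ε ^ (-a) * ∑ k, nearestDist δ x k ^ 2 + Fintype.card ι * ε ^ (2 - a) := by
        rw [Finset.sum_add_distrib, ← Finset.mul_sum, Finset.sum_const, Finset.card_univ,
          nsmul_eq_mul]
    _ ≤ _ := by gcongr

theorem exists_setLIntegral_nearestKernel_le (ha : 0 ≤ a) (ha1 : a < 1) (hδ : 0 ≤ δ) (hD : 0 ≤ D)
    {S : Set ℂ} (hS : S ⊆ Metric.ball 0 D) :
    ∃ B, 0 ≤ B ∧ ∀ {n : ℕ} [NeZero n] (x : Fin n → ℂ), (∀ k, x k ∈ Metric.ball 0 D) →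
      ∫⁻ z in S, nearestKernel a δ ((n : ℝ) ^ (-(1 / 2) : ℝ)) x z ≤
        ENNReal.ofReal (B * (n : ℝ) ^ (a / 2)) := by
  have : 0 < 1 - a := sub_pos.2 ha1
  refine ⟨(δ ^ (-a) + 1) * (Real.pi * D ^ 2) +
    (2 * Real.pi / (2 - a) + Real.pi / (1 - a) * ((2 * D + δ) ^ 2 + 1)), ?_, fun {n} _ x hx => ?_⟩
  · have : 0 < 2 - a := by linarith
    positivity
  have hn : (0 : ℝ) < n := mod_cast NeZero.pos n
  have hε : 0 < (n : ℝ) ^ (-(1 / 2) : ℝ) := Real.rpow_pos_of_pos hn _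
  have hεa : ((n : ℝ) ^ (-(1 / 2) : ℝ)) ^ (-a) = (n : ℝ) ^ (a / 2) := by
    rw [← Real.rpow_mul hn.le]
    ring_nf
  have hnε : n * ((n : ℝ) ^ (-(1 / 2) : ℝ)) ^ (2 - a) = (n : ℝ) ^ (a / 2) := by
    rw [← Real.rpow_mul hn.le, mul_comm, ← Real.rpow_add_one hn.ne']
    ring_nf
  have hsum := sum_nearestDist_rpow_le ha (by linarith) hδ hε hD hx
  have hbound := setLIntegral_nearestKernel_le ha ha1 hδ hε.le hD x hS
  rw [Fintype.card_fin, hεa, hnε] at hsum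
  rw [Fintype.card_fin, hεa, mul_left_comm (n : ℝ), hnε] at hbound
  have hN : 1 ≤ (n : ℝ) ^ (a / 2) :=
    Real.one_le_rpow (mod_cast NeZero.one_le) (by linarith)
  refine hbound.trans (ENNReal.ofReal_le_ofReal ?_)
  calc _ ≤ (δ ^ (-a) * (n : ℝ) ^ (a / 2) + (n : ℝ) ^ (a / 2)) * (Real.pi * D ^ 2) +
        (2 * Real.pi / (2 - a) * (n : ℝ) ^ (a / 2) + Real.pi / (1 - a) *
          ((n : ℝ) ^ (a / 2) * (2 * D + δ) ^ 2 + (n : ℝ) ^ (a / 2))) := by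
        gcongr
        exact le_mul_of_one_le_right (by positivity) hN
    _ = _ := by ring

end KernelIntegral

theorem lintegral_pi_le_lintegral_snoc {X : Type*} [MeasurableSpace X] (ν : Measure X)
    [SigmaFinite ν] {m : ℕ} (f : (Fin (m + 1) → X) → ENNReal) :
    ∫⁻ y, f y ∂Measure.pi (fun _ => ν) ≤
      ∫⁻ y, ∫⁻ z, f (Fin.snoc (α := fun _ => X) y z) ∂ν ∂Measure.pi (fun _ : Fin m => ν) := by
  have hinsert :=
    (measurePreserving_piFinSuccAbove (fun _ : Fin (m + 1) => ν) (Fin.last m)).symm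
  have hswap := Measure.measurePreserving_swap (μ := Measure.pi fun _ : Fin m => ν) (ν := ν)
  rw [← hinsert.lintegral_comp_emb (MeasurableEquiv.measurableEmbedding _),
    ← hswap.lintegral_comp_emb MeasurableEquiv.prodComm.measurableEmbedding]
  refine (lintegral_prod_le _).trans_eq ?_
  simp [MeasurableEquiv.piFinSuccAbove, Fin.snocEquiv]

theorem ae_pi_restrict_mem {ι : Type*} [Fintype ι] {X : ι → Type*} [∀ i, MeasurableSpace (X i)]
    (μ : ∀ i, Measure (X i)) [∀ i, SigmaFinite (μ i)] {s : ∀ i, Set (X i)}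
    (hs : ∀ i, MeasurableSet (s i)) :
    ∀ᵐ y ∂Measure.pi (fun i => (μ i).restrict (s i)), ∀ i, y i ∈ s i :=
  ae_all_iff.2 fun i =>
    (Measure.tendsto_eval_ae_ae (μ := fun i => (μ i).restrict (s i)) (i := i)).eventually
      (ae_restrict_mem (hs i))

section WeightIntegral

variable {a δ D : ℝ} {S : Set ℂ}

theorem exists_setLIntegral_nearestWeight_snoc_le (ha : 0 ≤ a) (ha1 : a < 1) (hδ : 0 < δ)
    (hD : 0 ≤ D) (hS : S ⊆ Metric.ball 0 D) :
    ∃ B, 0 ≤ B ∧ ∀ {n : ℕ} [NeZero n] (x : Fin n → ℂ), (∀ k, x k ∈ Metric.ball 0 D) →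
      ∫⁻ z in S, ENNReal.ofReal (nearestWeight a δ (Fin.snoc (α := fun _ => ℂ) x z)) ≤
        ENNReal.ofReal (nearestWeight a δ x) * ENNReal.ofReal (B * (n : ℝ) ^ (a / 2)) := by
  obtain ⟨B, hB, hkernel⟩ := exists_setLIntegral_nearestKernel_le ha ha1 hδ.le hD hS
  refine ⟨2 ^ Besicovitch.multiplicity ℂ * B, by positivity, fun {n} _ x hx => ?_⟩
  have hε : 0 < (n : ℝ) ^ (-(1 / 2) : ℝ) := Real.rpow_pos_of_pos (mod_cast NeZero.pos n) _
  have hstep : ∀ z, ENNReal.ofReal (nearestWeight a δ (Fin.snoc (α := fun _ => ℂ) x z)) ≤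
      2 ^ Besicovitch.multiplicity ℂ * (ENNReal.ofReal (nearestWeight a δ x) *
        nearestKernel a δ ((n : ℝ) ^ (-(1 / 2) : ℝ)) x z) := fun z => by
    simpa only [Fin.snoc_castSucc, Fin.snoc_last] using
      ofReal_nearestWeight_le ha ha1.le hδ hε (Fin.snoc (α := fun _ => ℂ) x z)
  refine (lintegral_mono hstep).trans ?_
  rw [lintegral_const_mul' _ _ (by finiteness), lintegral_const_mul' _ _ ENNReal.ofReal_ne_top,
    mul_left_comm, mul_assoc (2 ^ _) B, ENNReal.ofReal_mul (p := 2 ^ _) (by positivity),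
    ENNReal.ofReal_pow zero_le_two, ENNReal.ofReal_ofNat]
  gcongr
  exact hkernel x hx

theorem exists_lintegral_nearestWeight_cons_le (ha : 0 ≤ a) (ha1 : a < 1) (hδ : 0 < δ)
    (hD : 0 ≤ D) (hSm : MeasurableSet S) (hS : S ⊆ Metric.ball 0 D) :
    ∃ B, 0 ≤ B ∧ ∀ x₁ ∈ Metric.ball (0 : ℂ) D, ∀ m : ℕ,
      ∫⁻ y, ENNReal.ofReal (nearestWeight a δ (Fin.cons x₁ y : Fin (m + 1) → ℂ))
        ∂Measure.pi (fun _ => volume.restrict S) ≤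
      ENNReal.ofReal (δ ^ (-a) * (B * ((m + 1 : ℕ) : ℝ) ^ (a / 2)) ^ m) := by
  obtain ⟨B, hB, hsnoc⟩ := exists_setLIntegral_nearestWeight_snoc_le ha ha1 hδ hD hS
  refine ⟨B, hB, fun x₁ hx₁ m => ?_⟩
  induction m with
  | zero => simp [nearestWeight, nearestDist]
  | succ m ih =>
    have hlast : ∀ᵐ y ∂Measure.pi (fun _ : Fin m => volume.restrict S),
        ∫⁻ z in S, ENNReal.ofReal (nearestWeight a δ
          (Fin.cons x₁ (Fin.snoc (α := fun _ => ℂ) y z) : Fin (m + 1 + 1) → ℂ)) ≤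
        ENNReal.ofReal (nearestWeight a δ (Fin.cons x₁ y : Fin (m + 1) → ℂ)) *
          ENNReal.ofReal (B * ((m + 1 : ℕ) : ℝ) ^ (a / 2)) := by
      filter_upwards [ae_pi_restrict_mem (fun _ : Fin m => volume) fun _ => hSm] with y hy
      simp_rw [Fin.cons_snoc_eq_snoc_cons]
      exact hsnoc _ (Fin.cases hx₁ fun j => hS (hy j))
    refine (lintegral_pi_le_lintegral_snoc _ _).trans ((lintegral_mono_ae hlast).trans ?_)
    rw [lintegral_mul_const' _ _ ENNReal.ofReal_ne_top]
    refine (mul_le_mul_left ih _).trans ?_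
    rw [← ENNReal.ofReal_mul (by positivity), mul_assoc, ← pow_succ]
    gcongr
    omega

end WeightIntegral

theorem exp_half_sq_mul_sub_log_le {q κ B r : ℝ} (hq : |q| ≤ κ) (hB : 0 ≤ B) (hr : 0 < r)
    (hr1 : r ≤ 1) :
    Real.exp (1 / 2 * (q ^ 2 * (B - 1 / (2 * Real.pi) * Real.log r))) ≤
      Real.exp (κ ^ 2 * B / 2) * r ^ (-(κ ^ 2 / (4 * Real.pi))) := by
  have hlog : 0 ≤ B - 1 / (2 * Real.pi) * Real.log r := by
    have : 1 / (2 * Real.pi) * Real.log r ≤ 0 :=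
      mul_nonpos_of_nonneg_of_nonpos (by positivity) (Real.log_nonpos hr.le hr1)
    linarith
  rw [Real.rpow_def_of_pos hr, ← Real.exp_add, Real.exp_le_exp, ← sq_abs q]
  calc 1 / 2 * (|q| ^ 2 * (B - 1 / (2 * Real.pi) * Real.log r))
      ≤ 1 / 2 * (κ ^ 2 * (B - 1 / (2 * Real.pi) * Real.log r)) := by gcongr
    _ = κ ^ 2 * B / 2 + Real.log r * (-(κ ^ 2 / (4 * Real.pi))) := by
      field_simp
      ring

theorem exists_exp_neg_coulombEnergy_le {Ω : Set ℂ} (ho : IsOpen Ω)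
    (hb : Bornology.IsBounded Ω) (κ : ℝ) :
    ∃ A : ℝ, 1 ≤ A ∧ ∀ {δ : ℝ}, 0 < δ → δ ≤ 1 → ∀ {n : ℕ} (α : Fin n → ℝ) (x : Fin n → ℂ),
      (∀ k, |α k| ≤ κ) → Function.Injective x → (∀ k, Metric.closedBall (x k) δ ⊆ Ω) →
      Real.exp (-coulombEnergy Ω α x) ≤ A ^ n * nearestWeight (κ ^ 2 / (4 * Real.pi)) δ x := by
  obtain ⟨B, hB, hBE⟩ := exists_neg_coulombEnergy_le ho hb
  set a := κ ^ 2 / (4 * Real.pi) with ha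
  refine ⟨Real.exp (κ ^ 2 * B / 2) * 2 ^ a, one_le_mul_of_one_le_of_one_le
    (Real.one_le_exp (by positivity)) (Real.one_le_rpow one_le_two (by positivity)),
    fun {δ} hδ hδ1 {n} α x hα hx hball => ?_⟩
  set s := nearestDist δ x
  have hs : ∀ k, 0 < s k := fun k => nearestDist_pos hδ hx
  have hsδ : ∀ k, s k ≤ δ := fun k => nearestDist_le
  have henergy := hBE α x (fun k => s k / 2) (fun k => half_pos (hs k))
    (fun k => by linarith [hsδ k, hs k])
    (fun k => (Metric.closedBall_subset_closedBall (by linarith [hsδ k, hs k])).trans (hball k))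
    (fun k l hkl => by
      have hk : s k ≤ dist (x k) (x l) := nearestDist_le_dist hkl.symm
      have hl : s l ≤ dist (x l) (x k) := nearestDist_le_dist hkl
      rw [dist_comm] at hl
      rw [← dist_eq_norm]
      linarith)
  calc Real.exp (-coulombEnergy Ω α x)
      ≤ ∏ k, Real.exp (1 / 2 * (α k ^ 2 * (B - 1 / (2 * Real.pi) * Real.log (s k / 2)))) := by
        rw [← Real.exp_sum, ← Finset.mul_sum]
        exact Real.exp_le_exp.2 henergy
    _ ≤ ∏ k, Real.exp (κ ^ 2 * B / 2) * 2 ^ a * s k ^ (-a) := by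
        refine Finset.prod_le_prod (fun k _ => (Real.exp_pos _).le) fun k _ => ?_
        refine (exp_half_sq_mul_sub_log_le (hα k) hB (half_pos (hs k))
          (by linarith [hsδ k, hs k])).trans_eq ?_
        rw [← ha, Real.div_rpow (hs k).le zero_le_two, Real.rpow_neg zero_le_two, div_inv_eq_mul,
          mul_comm (s k ^ _), mul_assoc]
    _ = (Real.exp (κ ^ 2 * B / 2) * 2 ^ a) ^ n * nearestWeight a δ x := by
        rw [Finset.prod_mul_distrib, Finset.prod_const, Finset.card_univ, Fintype.card_fin]
        rfl

theorem abs_sum_sum_Ioi_le {n : ℕ} {F : Fin n → Fin n → ℝ} {c : ℝ} (hF : ∀ k l, |F k l| ≤ c) :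
    |∑ k, ∑ l ∈ Finset.Ioi k, F k l| ≤ (n : ℝ) ^ 2 * c := by
  calc |∑ k, ∑ l ∈ Finset.Ioi k, F k l|
      ≤ ∑ k, ∑ l ∈ Finset.Ioi k, |F k l| :=
        (Finset.abs_sum_le_sum_abs _ _).trans
          (Finset.sum_le_sum fun k _ => Finset.abs_sum_le_sum_abs _ _)
    _ ≤ ∑ _k : Fin n, ∑ _l : Fin n, c :=
        Finset.sum_le_sum fun k _ =>
          (Finset.sum_le_sum_of_subset_of_nonneg (Finset.subset_univ _)
            fun _ _ _ => abs_nonneg _).trans (Finset.sum_le_sum fun l _ => hF k l)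
    _ = (n : ℝ) ^ 2 * c := by
        simp only [Finset.sum_const, Finset.card_univ, Fintype.card_fin, nsmul_eq_mul]
        ring

theorem exists_abs_coulombEnergy_add_sub_le {Ω : Set ℂ} (ho : IsOpen Ω)
    (hb : Bornology.IsBounded Ω) {δ : ℝ} (hδ : 0 < δ) (κ : ℝ) :
    ∃ L : ℝ, 0 ≤ L ∧ ∀ {n : ℕ} (α : Fin n → ℝ) (x : Fin n → ℂ) (h : ℂ),
      (∀ k, |α k| ≤ κ) → (∀ k, Metric.closedBall (x k) (2 * δ) ⊆ Ω) → ‖h‖ < δ →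
      |coulombEnergy Ω α (fun k => x k + h) - coulombEnergy Ω α x| ≤
        L * ((n : ℝ) ^ 2 * ‖h‖) := by
  obtain ⟨L, hL, hGL⟩ := exists_abs_greenFunction_add_sub_le ho hb hδ
  refine ⟨κ ^ 2 * L, by positivity, fun {n} α x h hα hball hh => ?_⟩
  have hterm : ∀ k l, |α k * α l * (greenFunction Ω (x k + h) (x l + h) -
      greenFunction Ω (x k) (x l))| ≤ κ * κ * (L * ‖h‖) := fun k l => by
    have hκ : 0 ≤ κ := (abs_nonneg _).trans (hα k)
    rw [abs_mul, abs_mul]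
    gcongr
    exacts [hα k, hα l, hGL _ _ _ (hball k) (hball l) hh]
  simp only [coulombEnergy, ← Finset.sum_sub_distrib, ← mul_sub]
  refine (abs_sum_sum_Ioi_le hterm).trans_eq ?_
  ring

theorem norm_prod_le_pow_card {R ι : Type*} [NormedCommRing R] [NormOneClass R]
    (s : Finset ι) {a : ι → R} {M : ℝ} (ha : ∀ i ∈ s, ‖a i‖ ≤ M) :
    ‖∏ i ∈ s, a i‖ ≤ M ^ s.card := by
  refine (Finset.norm_prod_le s a).trans ?_
  rw [← Finset.prod_const]
  exact Finset.prod_le_prod (fun _ _ => norm_nonneg _) ha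

theorem norm_prod_sub_prod_le {R ι : Type*} [NormedCommRing R] [NormOneClass R]
    (s : Finset ι) {a b : ι → R} {M e : ℝ} (ha : ∀ i ∈ s, ‖a i‖ ≤ M) (hb : ∀ i ∈ s, ‖b i‖ ≤ M)
    (hab : ∀ i ∈ s, ‖a i - b i‖ ≤ M * e) :
    ‖∏ i ∈ s, a i - ∏ i ∈ s, b i‖ ≤ s.card * (M ^ s.card * e) := by
  classical
  induction s using Finset.induction_on with
  | empty => simp
  | insert i s hi ih =>
    simp only [Finset.forall_mem_insert] at ha hb hab
    have hM : 0 ≤ M := (norm_nonneg _).trans ha.1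
    rw [Finset.prod_insert hi, Finset.prod_insert hi, Finset.card_insert_of_notMem hi]
    calc ‖a i * ∏ j ∈ s, a j - b i * ∏ j ∈ s, b j‖
        = ‖a i * (∏ j ∈ s, a j - ∏ j ∈ s, b j) + (a i - b i) * ∏ j ∈ s, b j‖ := by
          congr 1
          ring
      _ ≤ ‖a i‖ * ‖∏ j ∈ s, a j - ∏ j ∈ s, b j‖ + ‖a i - b i‖ * ‖∏ j ∈ s, b j‖ :=
          (norm_add_le _ _).trans (add_le_add (norm_mul_le _ _) (norm_mul_le _ _))
      _ ≤ M * (s.card * (M ^ s.card * e)) + M * e * M ^ s.card :=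
          add_le_add (mul_le_mul ha.1 (ih ha.2 hb.2 hab.2) (norm_nonneg _) hM)
            (mul_le_mul hab.1 (norm_prod_le_pow_card s hb.2) (norm_nonneg _)
              ((norm_nonneg _).trans hab.1))
      _ = (s.card + 1 : ℕ) * (M ^ (s.card + 1) * e) := by
          push_cast
          ring

theorem cons_add_const {G : Type*} [Add G] {m : ℕ} (x h : G) (y : Fin m → G) :
    (Fin.cons (x + h) (y + fun _ => h) : Fin (m + 1) → G) =
      fun k => (Fin.cons x y : Fin (m + 1) → G) k + h := by
  funext k
  exact Fin.cases rfl (fun _ => rfl) k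

theorem ae_injective_cons {E : Type*} [NormedAddCommGroup E] [NormedSpace ℝ E]
    [FiniteDimensional ℝ E] [MeasureSpace E] [BorelSpace E]
    [(volume : Measure E).IsAddHaarMeasure] [Nontrivial E] (x : E) (m : ℕ) :
    ∀ᵐ y : Fin m → E, Function.Injective (Fin.cons x y : Fin (m + 1) → E) := by
  have hne : ∀ᵐ y : Fin m → E, ∀ j, y j ≠ x := by
    rw [ae_all_iff, volume_pi]
    exact fun j => Measure.ae_eval_ne (fun _ => (volume : Measure E)) j x
  have hpair : ∀ᵐ y : Fin m → E, ∀ i j, i ≠ j → y i ≠ y j := by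
    simp only [ae_all_iff]
    intro i j hij
    set V : Submodule ℝ (Fin m → E) :=
      LinearMap.ker ((LinearMap.proj i : (Fin m → E) →ₗ[ℝ] E) - LinearMap.proj j) with hV
    have hVtop : V ≠ ⊤ := fun h => by
      obtain ⟨v, hv⟩ := exists_ne (0 : E)
      have hmem : (Pi.single i v : Fin m → E) ∈ V := h ▸ Submodule.mem_top
      rw [hV, LinearMap.mem_ker] at hmem
      simp [hij.symm, hv] at hmem
    have hnull := Measure.addHaar_submodule volume V hVtop
    filter_upwards [compl_mem_ae_iff.2 hnull] with y hy hyij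
    exact hy (by simp [hV, LinearMap.mem_ker, hyij])
  filter_upwards [hne, hpair] with y hy hy'
  rw [Fin.cons_injective_iff]
  exact ⟨fun ⟨j, hj⟩ => hy j hj, fun i j hij => not_ne_iff.1 fun h => hy' i j h hij⟩

theorem exists_cthickening_closedBall_subset {X : Type*} [PseudoMetricSpace X] {K U : Set X}
    (hK : IsCompact K) (hU : IsOpen U) (hKU : K ⊆ U) :
    ∃ δ : ℝ, 0 < δ ∧ δ ≤ 1 ∧ ∀ z ∈ Metric.cthickening δ K, Metric.closedBall z (2 * δ) ⊆ U := by
  obtain ⟨ε, hε, hεU⟩ := hK.exists_cthickening_subset_open hU hKU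
  have hδ : 0 < min 1 (ε / 3) := by positivity
  refine ⟨min 1 (ε / 3), hδ, min_le_left _ _, fun z hz => ?_⟩
  refine (Metric.closedBall_subset_cthickening hz _).trans <|
    (Metric.cthickening_cthickening_subset (by positivity) hδ.le K).trans <|
    (Metric.cthickening_mono ?_ K).trans hεU
  linarith [min_le_right 1 (ε / 3)]

theorem lintegral_enorm_le_of_norm_le_mul {X E : Type*} [MeasurableSpace X] {μ : Measure X}
    [NormedAddCommGroup E] {s : Set X} {F : X → E} {φ : X → ℝ} {q R : ℝ} (hs : MeasurableSet s)
    (hq : 0 ≤ q) (hF0 : ∀ y ∉ s, F y = 0) (hF : ∀ y ∈ s, ‖F y‖ ≤ q * φ y)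
    (hφ : ∫⁻ y in s, ENNReal.ofReal (φ y) ∂μ ≤ ENNReal.ofReal R) :
    ∫⁻ y, ‖F y‖ₑ ∂μ ≤ ENNReal.ofReal (q * R) := by
  calc ∫⁻ y, ‖F y‖ₑ ∂μ
      ≤ ∫⁻ y, s.indicator (fun y => ENNReal.ofReal q * ENNReal.ofReal (φ y)) y ∂μ := by
        refine lintegral_mono fun y => ?_
        by_cases hy : y ∈ s
        · rw [Set.indicator_of_mem hy, ← ENNReal.ofReal_mul hq, ← ofReal_norm]
          exact ENNReal.ofReal_le_ofReal (hF y hy)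
        · simp [hF0 y hy, hy]
    _ = ENNReal.ofReal q * ∫⁻ y in s, ENNReal.ofReal (φ y) ∂μ := by
        rw [lintegral_indicator hs, lintegral_const_mul' _ _ ENNReal.ofReal_ne_top]
    _ ≤ ENNReal.ofReal (q * R) := by
        rw [ENNReal.ofReal_mul hq]
        gcongr

theorem forall_cons_mem {X : Type*} {m : ℕ} {s : Set X} {x : X} {y : Fin m → X} (hx : x ∈ s)
    (hy : y ∈ Set.univ.pi fun _ : Fin m => s) (k : Fin (m + 1)) :
    (Fin.cons x y : Fin (m + 1) → X) k ∈ s :=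
  Fin.cases hx (fun j => hy j (Set.mem_univ j)) k

theorem pow_le_add_one_pow_succ {b : ℝ} (hb : 0 ≤ b) (m : ℕ) : b ^ m ≤ (b + 1) ^ (m + 1) :=
  (pow_le_pow_left₀ hb (by linarith) m).trans (pow_le_pow_right₀ (by linarith) m.le_succ)

theorem exists_lintegral_exp_neg_coulombEnergy_le {Ω : Set ℂ} (ho : IsOpen Ω)
    (hb : Bornology.IsBounded Ω) {κ δ : ℝ} (hκ : 0 ≤ κ) (hκ1 : κ < Real.sqrt (4 * Real.pi))
    (hδ : 0 < δ) (hδ1 : δ ≤ 1) {T : Set ℂ} (hTm : MeasurableSet T)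
    (hT : ∀ z ∈ T, Metric.closedBall z δ ⊆ Ω) :
    ∃ C : ℝ, 1 ≤ C ∧ ∀ (m : ℕ) (α : Fin (m + 1) → ℝ), (∀ k, |α k| ≤ κ) → ∀ x₁ ∈ T,
      ∫⁻ y in Set.univ.pi fun _ : Fin m => T,
        ENNReal.ofReal (Real.exp (-coulombEnergy Ω α (Fin.cons x₁ y : Fin (m + 1) → ℂ))) ≤
      ENNReal.ofReal ((C * ((m + 1 : ℕ) : ℝ) ^ (κ ^ 2 / (8 * Real.pi))) ^ (m + 1)) := by
  set a := κ ^ 2 / (4 * Real.pi) with ha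
  have ha0 : 0 ≤ a := by positivity
  have ha1 : a < 1 := by
    rw [ha, div_lt_one (by positivity)]
    exact (Real.lt_sqrt hκ).1 hκ1
  obtain ⟨D, hD0, hD⟩ := hb.subset_ball_lt 0 0
  have hTD : T ⊆ Metric.ball 0 D := fun z hz =>
    hD (hT z hz (Metric.mem_closedBall_self hδ.le))
  obtain ⟨A, hA, hexp⟩ := exists_exp_neg_coulombEnergy_le ho hb κ
  obtain ⟨B, hB, hweight⟩ := exists_lintegral_nearestWeight_cons_le ha0 ha1 hδ hD0.le hTm hTD
  have hδa : 1 ≤ δ ^ (-a) := Real.one_le_rpow_of_pos_of_le_one_of_nonpos hδ hδ1 (by linarith)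
  refine ⟨A * δ ^ (-a) * (B + 1), one_le_mul_of_one_le_of_one_le
    (one_le_mul_of_one_le_of_one_le hA hδa) (by linarith), fun m α hα x₁ hx₁ => ?_⟩
  set N := ((m + 1 : ℕ) : ℝ) ^ (a / 2) with hN
  have hN1 : 1 ≤ N := Real.one_le_rpow (by simp) (by linarith)
  rw [show κ ^ 2 / (8 * Real.pi) = a / 2 by rw [ha]; ring, ← hN]
  calc ∫⁻ y in Set.univ.pi fun _ : Fin m => T,
        ENNReal.ofReal (Real.exp (-coulombEnergy Ω α (Fin.cons x₁ y : Fin (m + 1) → ℂ)))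
      ≤ ∫⁻ y in Set.univ.pi fun _ : Fin m => T, ENNReal.ofReal (A ^ (m + 1)) *
          ENNReal.ofReal (nearestWeight a δ (Fin.cons x₁ y : Fin (m + 1) → ℂ)) := by
        refine lintegral_mono_ae ?_
        filter_upwards [ae_restrict_of_ae (ae_injective_cons x₁ m),
          ae_restrict_mem (MeasurableSet.univ_pi fun _ => hTm)] with y hy hyT
        rw [← ENNReal.ofReal_mul (by positivity)]
        exact ENNReal.ofReal_le_ofReal (hexp hδ hδ1 α _ hα hy fun k =>
          hT _ (forall_cons_mem hx₁ hyT k))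
    _ ≤ ENNReal.ofReal (A ^ (m + 1)) * ENNReal.ofReal (δ ^ (-a) * (B * N) ^ m) := by
        rw [lintegral_const_mul' _ _ ENNReal.ofReal_ne_top, volume_pi, Measure.restrict_pi_pi]
        gcongr
        exact hweight x₁ (hTD hx₁) m
    _ ≤ ENNReal.ofReal ((A * δ ^ (-a) * (B + 1) * N) ^ (m + 1)) := by
        rw [← ENNReal.ofReal_mul (by positivity)]
        simp only [mul_pow, mul_assoc]
        gcongr
        exacts [le_self_pow₀ hδa m.succ_ne_zero, pow_le_add_one_pow_succ hB m, m.le_succ]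

/-- A function vanishing outside `K` which on `Ω` is bounded by `M` and Lipschitz with constant
`M`: all that is used of the factors `f_j` of the integrand. -/
structure IsLipschitzTestFunction (Ω K : Set ℂ) (M : ℝ) (f : ℂ → ℂ) : Prop where
  support_subset : Function.support f ⊆ K
  norm_le : ∀ z ∈ Ω, ‖f z‖ ≤ M
  norm_sub_le : ∀ z ∈ Ω, ∀ w ∈ Ω, ‖f z - f w‖ ≤ M * ‖z - w‖

theorem IsLipschitzTestFunction.measurable {Ω K : Set ℂ} {M : ℝ} {f : ℂ → ℂ}
    (hf : IsLipschitzTestFunction Ω K M f) (ho : IsOpen Ω) (hKΩ : K ⊆ Ω) : Measurable f := by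
  have hcont : ContinuousOn f Ω := by
    refine (LipschitzOnWith.of_dist_le_mul (K := M.toNNReal) fun z hz w hw => ?_).continuousOn
    rw [dist_eq_norm, dist_eq_norm]
    exact (hf.norm_sub_le z hz w hw).trans (by gcongr; exact Real.le_coe_toNNReal M)
  classical
  rw [← Set.indicator_eq_self.2 (hf.support_subset.trans hKΩ), ← Set.piecewise_eq_indicator]
  exact hcont.measurable_piecewise continuousOn_const ho.measurableSet

theorem norm_integral_le_of_lintegral_enorm_le {X E : Type*} [MeasurableSpace X] {μ : Measure X}
    [NormedAddCommGroup E] [NormedSpace ℝ E] {F : X → E} {R : ℝ} (hR : 0 ≤ R)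
    (hF : ∫⁻ y, ‖F y‖ₑ ∂μ ≤ ENNReal.ofReal R) : ‖∫ y, F y ∂μ‖ ≤ R := by
  rw [← ENNReal.ofReal_le_ofReal_iff hR, ofReal_norm]
  exact (enorm_integral_le_lintegral_enorm F).trans hF

section OnePoint

variable {Ω K : Set ℂ} {δ M R : ℝ} {m : ℕ} {α : Fin (m + 1) → ℝ} {f : Fin m → ℂ → ℂ}
  {x h : ℂ} {y : Fin m → ℂ}

theorem support_onePointIntegrand_subset :
    Function.support (onePointIntegrand Ω α f x) ⊆
      Set.univ.pi fun j => Function.support (f j) := fun y hy j _ => by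
  rw [Function.mem_support, onePointIntegrand] at hy
  exact Finset.prod_ne_zero_iff.1 (left_ne_zero_of_mul hy) j (Finset.mem_univ j)

theorem onePointIntegral_eq_integral (hf : ∀ j, Function.support (f j) ⊆ Ω) :
    onePointIntegral Ω α f x = ∫ y, onePointIntegrand Ω α f x y :=
  setIntegral_eq_integral_of_forall_compl_eq_zero fun _ hy => Function.notMem_support.1
    fun h => hy (Set.pi_mono (fun j _ => hf j) (support_onePointIntegrand_subset h))

theorem measurable_onePointIntegrand (ho : IsOpen Ω) (hb : Bornology.IsBounded Ω)
    (hf : ∀ j, Measurable (f j)) (hfΩ : ∀ j, Function.support (f j) ⊆ Ω) (hx : x ∈ Ω) :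
    Measurable (onePointIntegrand Ω α f x) := by
  set E : (Fin m → ℂ) → ℝ := fun y => ∑ k, ∑ l ∈ Finset.Ioi k, α k * α l *
    (Ω ×ˢ Ω).indicator (Function.uncurry (greenFunction Ω))
      ((Fin.cons x y : Fin (m + 1) → ℂ) k, (Fin.cons x y : Fin (m + 1) → ℂ) l)
  have hcons : ∀ k, Measurable fun y : Fin m → ℂ => (Fin.cons x y : Fin (m + 1) → ℂ) k :=
    fun k => Fin.cases measurable_const measurable_pi_apply k
  have hE : Measurable E := Finset.measurable_fun_sum _ fun k _ =>
    Finset.measurable_fun_sum _ fun l _ => ((measurable_indicator_greenFunction ho hb).comp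
      ((hcons k).prodMk (hcons l))).const_mul _
  have heq : onePointIntegrand Ω α f x =
      fun y => (∏ j, f j (y j)) * (Real.exp (-E y) : ℂ) := by
    funext y
    by_cases hy : ∀ j, f j (y j) ≠ 0
    · have hmem := forall_cons_mem hx fun j _ => hfΩ j (hy j)
      simp only [E, Set.indicator_of_mem (Set.mk_mem_prod (hmem _) (hmem _))]
      rfl
    · obtain ⟨j, hj⟩ := not_forall_not.1 hy
      rw [onePointIntegrand, Finset.prod_eq_zero (Finset.mem_univ j) hj, zero_mul, zero_mul]
  rw [heq]
  fun_prop

theorem norm_onePointIntegrand_le (hM : ∀ j, ‖f j (y j)‖ ≤ M) :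
    ‖onePointIntegrand Ω α f x y‖ ≤
      M ^ m * Real.exp (-coulombEnergy Ω α (Fin.cons x y : Fin (m + 1) → ℂ)) := by
  rw [onePointIntegrand, norm_mul, Complex.norm_real, Real.norm_eq_abs, Real.abs_exp]
  gcongr
  simpa using norm_prod_le_pow_card Finset.univ fun j _ => hM j

theorem norm_onePointIntegrand_add_sub_le {t : ℝ} (hM : ∀ j, ‖f j (y j)‖ ≤ M)
    (hM' : ∀ j, ‖f j (y j + h)‖ ≤ M) (hL : ∀ j, ‖f j (y j + h) - f j (y j)‖ ≤ M * ‖h‖)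
    (ht : |coulombEnergy Ω α (fun k => (Fin.cons x y : Fin (m + 1) → ℂ) k + h) -
      coulombEnergy Ω α (Fin.cons x y : Fin (m + 1) → ℂ)| ≤ t) (ht1 : t ≤ 1) :
    ‖onePointIntegrand Ω α f (x + h) (y + fun _ => h) - onePointIntegrand Ω α f x y‖ ≤
      M ^ m * (2 * t + m * ‖h‖) *
        Real.exp (-coulombEnergy Ω α (Fin.cons x y : Fin (m + 1) → ℂ)) := by
  set e := coulombEnergy Ω α (Fin.cons x y : Fin (m + 1) → ℂ)
  set e' := coulombEnergy Ω α (fun k => (Fin.cons x y : Fin (m + 1) → ℂ) k + h)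
  have hfactor : onePointIntegrand Ω α f (x + h) (y + fun _ => h) - onePointIntegrand Ω α f x y =
      ((∏ j, f j (y j + h)) * ((Real.exp (e - e') - 1 : ℝ) : ℂ) +
        (∏ j, f j (y j + h) - ∏ j, f j (y j))) * (Real.exp (-e) : ℂ) := by
    have hexp : Real.exp (-e') = Real.exp (e - e') * Real.exp (-e) := by
      rw [← Real.exp_add]
      congr 1
      ring
    rw [onePointIntegrand, onePointIntegrand, cons_add_const, hexp]
    simp only [Pi.add_apply, Complex.ofReal_mul, Complex.ofReal_sub, Complex.ofReal_one]
    ring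
  have hexp_sub : |Real.exp (e - e') - 1| ≤ 2 * t := by
    rw [abs_sub_comm] at ht
    linarith [Real.abs_exp_sub_one_le (ht.trans ht1)]
  have hprod : ‖∏ j, f j (y j + h)‖ ≤ M ^ m := by
    simpa using norm_prod_le_pow_card Finset.univ fun j _ => hM' j
  have hprod_sub : ‖∏ j, f j (y j + h) - ∏ j, f j (y j)‖ ≤ m * (M ^ m * ‖h‖) := by
    simpa using norm_prod_sub_prod_le Finset.univ (fun j _ => hM' j) (fun j _ => hM j)
      fun j _ => hL j
  rw [hfactor, norm_mul, Complex.norm_real, Real.norm_eq_abs, Real.abs_exp]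
  gcongr
  calc _ ≤ ‖∏ j, f j (y j + h)‖ * |Real.exp (e - e') - 1| +
        ‖∏ j, f j (y j + h) - ∏ j, f j (y j)‖ := by
        refine (norm_add_le _ _).trans_eq ?_
        rw [norm_mul, Complex.norm_real, Real.norm_eq_abs]
    _ ≤ M ^ m * (2 * t) + m * (M ^ m * ‖h‖) :=
        add_le_add (mul_le_mul hprod hexp_sub (abs_nonneg _) ((norm_nonneg _).trans hprod))
          hprod_sub
    _ = M ^ m * (2 * t + m * ‖h‖) := by ring

theorem lintegral_enorm_onePointIntegrand_le {T : Set ℂ} (hT : MeasurableSet T) (hTΩ : T ⊆ Ω)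
    (hKT : K ⊆ T) (hM : 0 ≤ M) (hf : ∀ j, IsLipschitzTestFunction Ω K M (f j))
    (hR : ∫⁻ y in Set.univ.pi fun _ : Fin m => T,
      ENNReal.ofReal (Real.exp (-coulombEnergy Ω α (Fin.cons x y : Fin (m + 1) → ℂ))) ≤
        ENNReal.ofReal R) :
    ∫⁻ y, ‖onePointIntegrand Ω α f x y‖ₑ ≤ ENNReal.ofReal (M ^ m * R) := by
  refine lintegral_enorm_le_of_norm_le_mul (MeasurableSet.univ_pi fun _ => hT) (by positivity)
    (fun y hy => Function.notMem_support.1 fun h => hy ?_)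
    (fun y hy => norm_onePointIntegrand_le fun j =>
      (hf j).norm_le _ (hTΩ (hy j (Set.mem_univ j)))) hR
  exact Set.pi_mono (fun j _ => (hf j).support_subset.trans hKT)
    (support_onePointIntegrand_subset h)

theorem lintegral_enorm_onePointIntegrand_add_sub_le {t : ℝ} (hδ : 0 < δ)
    (hball : ∀ z ∈ Metric.cthickening δ K, Metric.closedBall z (2 * δ) ⊆ Ω) (hM : 0 ≤ M)
    (hf : ∀ j, IsLipschitzTestFunction Ω K M (f j)) (hh : ‖h‖ ≤ δ) (ht0 : 0 ≤ t) (ht1 : t ≤ 1)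
    (ht : ∀ y ∈ Set.univ.pi fun _ : Fin m => Metric.cthickening δ K,
      |coulombEnergy Ω α (fun k => (Fin.cons x y : Fin (m + 1) → ℂ) k + h) -
        coulombEnergy Ω α (Fin.cons x y : Fin (m + 1) → ℂ)| ≤ t)
    (hR : ∫⁻ y in Set.univ.pi fun _ : Fin m => Metric.cthickening δ K,
      ENNReal.ofReal (Real.exp (-coulombEnergy Ω α (Fin.cons x y : Fin (m + 1) → ℂ))) ≤
        ENNReal.ofReal R) :
    ∫⁻ y, ‖onePointIntegrand Ω α f (x + h) (y + fun _ => h) - onePointIntegrand Ω α f x y‖ₑ ≤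
      ENNReal.ofReal (M ^ m * (2 * t + m * ‖h‖) * R) := by
  refine lintegral_enorm_le_of_norm_le_mul
    (MeasurableSet.univ_pi fun _ => Metric.isClosed_cthickening.measurableSet) (by positivity)
    (fun y hy => ?_) (fun y hy => ?_) hR
  · have hsupp : ∀ z w, (∀ j, dist (y j) (w j) ≤ δ) → onePointIntegrand Ω α f z w = 0 :=
      fun z w hw => Function.notMem_support.1 fun hzw => hy fun j _ =>
        Metric.mem_cthickening_of_dist_le _ _ _ _
          ((hf j).support_subset (support_onePointIntegrand_subset hzw j (Set.mem_univ j))) (hw j)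
    rw [hsupp, hsupp, sub_zero]
    · simpa using fun _ => hδ.le
    · simpa using fun _ => hh
  · have hy' : ∀ j, y j ∈ Metric.cthickening δ K := fun j => hy j (Set.mem_univ j)
    have hmem : ∀ j, y j ∈ Ω := fun j =>
      hball _ (hy' j) (Metric.mem_closedBall_self (by positivity))
    have hmem' : ∀ j, y j + h ∈ Ω := fun j =>
      hball _ (hy' j) (by simpa using hh.trans (by linarith))
    refine norm_onePointIntegrand_add_sub_le (fun j => (hf j).norm_le _ (hmem j))
      (fun j => (hf j).norm_le _ (hmem' j)) (fun j => ?_) (ht y hy) ht1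
    simpa using (hf j).norm_sub_le _ (hmem' j) _ (hmem j)

theorem integrable_onePointIntegrand (ho : IsOpen Ω) (hb : Bornology.IsBounded Ω) (hKΩ : K ⊆ Ω)
    (hf : ∀ j, IsLipschitzTestFunction Ω K M (f j)) (hx : x ∈ Ω)
    (hfin : ∫⁻ y, ‖onePointIntegrand Ω α f x y‖ₑ < ⊤) :
    Integrable (onePointIntegrand Ω α f x) :=
  ⟨(measurable_onePointIntegrand ho hb (fun j => (hf j).measurable ho hKΩ)
    (fun j => (hf j).support_subset.trans hKΩ) hx).aestronglyMeasurable, hfin⟩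

-- Translating the integration variables along with `x` leaves the logarithms unchanged.
theorem onePointIntegral_add_sub (hfΩ : ∀ j, Function.support (f j) ⊆ Ω)
    (hx : Integrable (onePointIntegrand Ω α f x))
    (hxh : Integrable (onePointIntegrand Ω α f (x + h))) :
    onePointIntegral Ω α f (x + h) - onePointIntegral Ω α f x =
      ∫ y, (onePointIntegrand Ω α f (x + h) (y + fun _ => h) - onePointIntegrand Ω α f x y) := by
  rw [onePointIntegral_eq_integral hfΩ, onePointIntegral_eq_integral hfΩ,
    integral_sub (hxh.comp_add_right _) hx, integral_add_right_eq_self]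

theorem norm_onePointIntegral_add_sub_le {L : ℝ} (hδ : 0 < δ)
    (hball : ∀ z ∈ Metric.cthickening δ K, Metric.closedBall z (2 * δ) ⊆ Ω) (hM : 0 ≤ M)
    (hf : ∀ j, IsLipschitzTestFunction Ω K M (f j)) (hL : 0 ≤ L) (hR0 : 0 ≤ R)
    (hE : ‖h‖ < δ → ∀ y ∈ Set.univ.pi fun _ : Fin m => Metric.cthickening δ K,
      |coulombEnergy Ω α (fun k => (Fin.cons x y : Fin (m + 1) → ℂ) k + h) -
        coulombEnergy Ω α (Fin.cons x y : Fin (m + 1) → ℂ)| ≤ L * (((m + 1 : ℕ) : ℝ) ^ 2 * ‖h‖))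
    (hR : ∫⁻ y in Set.univ.pi fun _ : Fin m => Metric.cthickening δ K,
      ENNReal.ofReal (Real.exp (-coulombEnergy Ω α (Fin.cons x y : Fin (m + 1) → ℂ))) ≤
        ENNReal.ofReal R)
    (hx : Integrable (onePointIntegrand Ω α f x))
    (hxh : Integrable (onePointIntegrand Ω α f (x + h)))
    (hh : (L + 1 + 1 / δ) * ((m + 1 : ℕ) : ℝ) ^ 2 * ‖h‖ < 1) :
    ‖onePointIntegral Ω α f (x + h) - onePointIntegral Ω α f x‖ ≤
      2 * ((L + 1 + 1 / δ) * ((m + 1 : ℕ) : ℝ) ^ 2 * ‖h‖) * (M ^ m * R) := by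
  have hKΩ : K ⊆ Ω := fun z hz => hball z (Metric.self_subset_cthickening K hz)
    (Metric.mem_closedBall_self (by positivity))
  set u := ((m + 1 : ℕ) : ℝ) ^ 2 * ‖h‖ with hu
  have hhu : ‖h‖ ≤ u :=
    le_mul_of_one_le_left (norm_nonneg h) (one_le_pow₀ (by simp))
  have hu0 : 0 ≤ u := (norm_nonneg h).trans hhu
  have hmu : m * ‖h‖ ≤ 2 * u := by
    rw [hu, ← mul_assoc]
    gcongr
    push_cast
    nlinarith
  have hLu : 0 ≤ L * u := mul_nonneg hL hu0
  have huδ : 0 ≤ u / δ := div_nonneg hu0 hδ.le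
  have hsum : (L + 1 + 1 / δ) * ((m + 1 : ℕ) : ℝ) ^ 2 * ‖h‖ = L * u + u + u / δ := by
    rw [hu]
    ring
  rw [hsum] at hh ⊢
  have hhδ : ‖h‖ < δ := hhu.trans_lt ((div_lt_one hδ).1 (by linarith))
  rw [onePointIntegral_add_sub (fun j => (hf j).support_subset.trans hKΩ) hx hxh]
  refine (norm_integral_le_of_lintegral_enorm_le (by positivity)
    (lintegral_enorm_onePointIntegrand_add_sub_le hδ hball hM hf hhδ.le hLu (by linarith)
      (hE hhδ) hR)).trans ?_
  rw [mul_comm (M ^ m), mul_assoc]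
  gcongr
  linarith

end OnePoint

theorem exists_onePointIntegral_local_bounds {Ω K : Set ℂ} (ho : IsOpen Ω)
    (hb : Bornology.IsBounded Ω) (hK : IsCompact K) (hKΩ : K ⊆ Ω) {κ M : ℝ} (hκ : 0 ≤ κ)
    (hκ1 : κ < Real.sqrt (4 * Real.pi)) (hM : 0 ≤ M) :
    ∃ C Q : ℝ, 1 ≤ C ∧ 1 ≤ Q ∧ ∀ (m : ℕ) (α : Fin (m + 1) → ℝ) (f : Fin m → ℂ → ℂ),
      (∀ k, |α k| ≤ κ) → (∀ j, IsLipschitzTestFunction Ω K M (f j)) → ∀ R : ℝ,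
      R = M ^ m * (C * ((m + 1 : ℕ) : ℝ) ^ (κ ^ 2 / (8 * Real.pi))) ^ (m + 1) →
      ∀ x ∈ K, Integrable (onePointIntegrand Ω α f x) ∧ ‖onePointIntegral Ω α f x‖ ≤ R ∧
        ∀ h, x + h ∈ K → Q * ((m + 1 : ℕ) : ℝ) ^ 2 * ‖h‖ < 1 →
          ‖onePointIntegral Ω α f (x + h) - onePointIntegral Ω α f x‖ ≤
            2 * (Q * ((m + 1 : ℕ) : ℝ) ^ 2 * ‖h‖) * R := by
  obtain ⟨δ, hδ, hδ1, hball⟩ := exists_cthickening_closedBall_subset hK ho hKΩ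
  set T := Metric.cthickening δ K
  have hTm : MeasurableSet T := Metric.isClosed_cthickening.measurableSet
  have hKT : K ⊆ T := Metric.self_subset_cthickening K
  have hTΩ : T ⊆ Ω := fun z hz => hball z hz (Metric.mem_closedBall_self (by positivity))
  obtain ⟨C, hC, hCexp⟩ := exists_lintegral_exp_neg_coulombEnergy_le ho hb hκ hκ1 hδ hδ1 hTm
    fun z hz => (Metric.closedBall_subset_closedBall (by linarith)).trans (hball z hz)
  obtain ⟨L, hL, hLE⟩ := exists_abs_coulombEnergy_add_sub_le ho hb hδ κ
  refine ⟨C, L + 1 + 1 / δ, hC, by linarith [one_div_pos.2 hδ], ?_⟩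
  rintro m α f hα hf _ rfl
  set N := ((m + 1 : ℕ) : ℝ)
  have hfΩ : ∀ j, Function.support (f j) ⊆ Ω := fun j => (hf j).support_subset.trans hKΩ
  have hlint : ∀ x ∈ K, ∫⁻ y, ‖onePointIntegrand Ω α f x y‖ₑ ≤ ENNReal.ofReal
      (M ^ m * (C * N ^ (κ ^ 2 / (8 * Real.pi))) ^ (m + 1)) := fun x hx =>
    lintegral_enorm_onePointIntegrand_le hTm hTΩ hKT hM hf (hCexp m α hα x (hKT hx))
  have hint : ∀ x ∈ K, Integrable (onePointIntegrand Ω α f x) := fun x hx =>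
    integrable_onePointIntegrand ho hb hKΩ hf (hKΩ hx)
      ((hlint x hx).trans_lt ENNReal.ofReal_lt_top)
  refine fun x hx => ⟨hint x hx, ?_, fun h hxh hh => ?_⟩
  · rw [onePointIntegral_eq_integral hfΩ]
    exact norm_integral_le_of_lintegral_enorm_le (by positivity) (hlint x hx)
  exact norm_onePointIntegral_add_sub_le hδ hball hM hf hL (by positivity)
    (fun hhδ y hy => hLE α _ h hα (fun k => hball _ (forall_cons_mem (hKT hx) hy k)) hhδ)
    (hCexp m α hα x (hKT hx)) (hint x hx) (hint _ hxh) hh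

theorem natCast_sq_le_four_pow (n : ℕ) : (n : ℝ) ^ 2 ≤ 4 ^ n := by
  have hn : (n : ℝ) ≤ 2 ^ n := mod_cast n.lt_two_pow_self.le
  calc (n : ℝ) ^ 2 ≤ (2 ^ n) ^ 2 := by gcongr
    _ = 4 ^ n := by rw [← pow_mul, mul_comm, pow_mul]; norm_num

theorem exists_onePointIntegral_bounds {Ω K : Set ℂ} (ho : IsOpen Ω) (hb : Bornology.IsBounded Ω)
    (hK : IsCompact K) (hKΩ : K ⊆ Ω) {κ M : ℝ} (hκ : 0 ≤ κ) (hκ1 : κ < Real.sqrt (4 * Real.pi))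
    (hM : 0 ≤ M) :
    ∃ C : ℝ, 0 < C ∧ ∀ (m : ℕ) (α : Fin (m + 1) → ℝ) (f : Fin m → ℂ → ℂ),
      (∀ k, |α k| ≤ κ) → (∀ j, IsLipschitzTestFunction Ω K M (f j)) → ∀ P : ℝ,
      P = (C * ((m + 1 : ℕ) : ℝ) ^ (κ ^ 2 / (8 * Real.pi))) ^ (m + 1) →
      ∀ x ∈ K, Integrable (onePointIntegrand Ω α f x) ∧ ‖onePointIntegral Ω α f x‖ ≤ P ∧
        ∀ y ∈ K, ‖onePointIntegral Ω α f y - onePointIntegral Ω α f x‖ ≤ P * ‖y - x‖ := by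
  obtain ⟨C, Q, hC, hQ, hbound⟩ := exists_onePointIntegral_local_bounds ho hb hK hKΩ hκ hκ1 hM
  refine ⟨2 * Q * 4 * ((M + 1) * C), by positivity, ?_⟩
  rintro m α f hα hf _ rfl x hx
  have hloc := hbound m α f hα hf _ rfl
  set N := ((m + 1 : ℕ) : ℝ) with hN
  set R := M ^ m * (C * N ^ (κ ^ 2 / (8 * Real.pi))) ^ (m + 1) with hR
  have hR0 : 0 ≤ R := by positivity
  have hQN : 1 ≤ 2 * (Q * N ^ 2) := by
    have : 1 ≤ Q * N ^ 2 := one_le_mul_of_one_le_of_one_le hQ (one_le_pow₀ (by simp [hN]))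
    linarith
  have habsorb : 2 * (Q * N ^ 2) * R ≤
      (2 * Q * 4 * ((M + 1) * C) * N ^ (κ ^ 2 / (8 * Real.pi))) ^ (m + 1) := by
    rw [hR]
    set X := C * N ^ (κ ^ 2 / (8 * Real.pi)) with hX
    calc 2 * (Q * N ^ 2) * (M ^ m * X ^ (m + 1)) = 2 * Q * N ^ 2 * (M ^ m * X ^ (m + 1)) := by ring
      _ ≤ (2 * Q) ^ (m + 1) * 4 ^ (m + 1) * ((M + 1) ^ (m + 1) * X ^ (m + 1)) := by
        gcongr
        exacts [le_self_pow₀ (by linarith) m.succ_ne_zero, natCast_sq_le_four_pow _,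
          pow_le_add_one_pow_succ hM m]
      _ = (2 * Q * 4 * ((M + 1) * C) * N ^ (κ ^ 2 / (8 * Real.pi))) ^ (m + 1) := by
        rw [← mul_pow, ← mul_pow, ← mul_pow, hX]
        ring
  refine ⟨(hloc x hx).1, (hloc x hx).2.1.trans
    ((le_mul_of_one_le_left hR0 hQN).trans habsorb), fun y hy => ?_⟩
  refine le_trans ?_ (mul_le_mul_of_nonneg_right habsorb (norm_nonneg _))
  obtain ⟨h, rfl⟩ : ∃ h, y = x + h := ⟨y - x, by ring⟩
  rw [add_sub_cancel_left]
  rcases lt_or_ge (Q * N ^ 2 * ‖h‖) 1 with hsmall | hlarge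
  · exact ((hloc x hx).2.2 h hy hsmall).trans_eq (by ring)
  · calc ‖onePointIntegral Ω α f (x + h) - onePointIntegral Ω α f x‖ ≤ 2 * 1 * R := by
          linarith [norm_sub_le (onePointIntegral Ω α f (x + h)) (onePointIntegral Ω α f x),
            (hloc x hx).2.1, (hloc _ hy).2.1]
      _ ≤ 2 * (Q * N ^ 2 * ‖h‖) * R := by gcongr
      _ = 2 * (Q * N ^ 2) * R * ‖h‖ := by ring

section LipNorm

variable {A : Set ℂ} {f : ℂ → ℂ} {x y : ℂ}

theorem enorm_le_lipNorm (hx : x ∈ A) : ‖f x‖ₑ ≤ lipNorm A f :=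
  (le_iSup₂_of_le (f := fun x (_ : x ∈ A) => ‖f x‖ₑ) x hx le_rfl).trans le_self_add

theorem enorm_sub_le_lipNorm_mul (hx : x ∈ A) (hy : y ∈ A) :
    ‖f x - f y‖ₑ ≤ lipNorm A f * ‖x - y‖ₑ := by
  rcases eq_or_ne x y with rfl | hxy
  · simp
  refine (ENNReal.div_le_iff (by simpa [sub_eq_zero] using hxy) enorm_ne_top).1
    (le_trans ?_ (le_add_self (b := ⨆ x ∈ A, ‖f x‖ₑ)))
  exact le_iSup₂_of_le (f := fun x (_ : x ∈ A) => ⨆ y ∈ A, ⨆ _ : x ≠ y, ‖f x - f y‖ₑ / ‖x - y‖ₑ)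
    x hx (le_iSup₂_of_le (f := fun y (_ : y ∈ A) => ⨆ _ : x ≠ y, ‖f x - f y‖ₑ / ‖x - y‖ₑ)
      y hy (le_iSup_of_le hxy le_rfl))

theorem lipNorm_le_add {p q : ENNReal} (hp : ∀ x ∈ A, ‖f x‖ₑ ≤ p)
    (hq : ∀ x ∈ A, ∀ y ∈ A, ‖f x - f y‖ₑ ≤ q * ‖x - y‖ₑ) : lipNorm A f ≤ p + q := by
  refine add_le_add (iSup₂_le hp) (iSup₂_le fun x hx => iSup₂_le fun y hy => iSup_le fun hxy => ?_)
  exact (ENNReal.div_le_iff (by simpa [sub_eq_zero] using hxy) enorm_ne_top).2 (hq x hx y hy)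

theorem lipNorm_ne_top_of_hasCompactSupport (hf : ContDiff ℝ 1 f) (hc : HasCompactSupport f) :
    lipNorm A f ≠ ⊤ := by
  obtain ⟨B, hB⟩ := hc.exists_bound_of_continuous hf.continuous
  obtain ⟨L, hL⟩ := ContDiff.lipschitzWith_of_hasCompactSupport hc hf one_ne_zero
  refine ne_top_of_le_ne_top (ENNReal.add_ne_top.2 ⟨ENNReal.ofReal_ne_top, ENNReal.coe_ne_top⟩)
    (lipNorm_le_add (p := ENNReal.ofReal B) (q := L) (fun x _ => ?_) fun x _ y _ => ?_)
  · rw [← ofReal_norm]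
    exact ENNReal.ofReal_le_ofReal (hB x)
  · simpa only [edist_eq_enorm_sub] using hL x y

theorem lipNorm_le_ofReal_two_mul {P : ℝ} (hP : 0 ≤ P) (hf : ∀ x ∈ A, ‖f x‖ ≤ P)
    (hsub : ∀ x ∈ A, ∀ y ∈ A, ‖f x - f y‖ ≤ P * ‖x - y‖) :
    lipNorm A f ≤ ENNReal.ofReal (2 * P) := by
  rw [two_mul, ENNReal.ofReal_add hP hP]
  refine lipNorm_le_add (fun x hx => ?_) fun x hx y hy => ?_
  · rw [← ofReal_norm]
    exact ENNReal.ofReal_le_ofReal (hf x hx)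
  · rw [← ofReal_norm, ← ofReal_norm, ← ENNReal.ofReal_mul hP]
    exact ENNReal.ofReal_le_ofReal (hsub x hx y hy)

theorem isLipschitzTestFunction_of_lipNorm_le {K : Set ℂ} {M : ENNReal} (hM : M ≠ ⊤)
    (hfK : Function.support f ⊆ K) (hf : lipNorm A f ≤ M) :
    IsLipschitzTestFunction A K M.toReal f where
  support_subset := hfK
  norm_le z hz := by
    rw [← toReal_enorm]
    exact ENNReal.toReal_mono hM ((enorm_le_lipNorm hz).trans hf)
  norm_sub_le z hz w hw := by
    rw [← toReal_enorm, ← toReal_enorm, ← ENNReal.toReal_mul]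
    exact ENNReal.toReal_mono (ENNReal.mul_ne_top hM enorm_ne_top)
      ((enorm_sub_le_lipNorm_mul hz hw).trans (by gcongr))

end LipNorm

theorem chargeNorm_nonneg {n : ℕ} (α : Fin n → ℝ) : 0 ≤ chargeNorm α :=
  Real.iSup_nonneg fun _ => abs_nonneg _

theorem abs_le_chargeNorm {n : ℕ} (α : Fin n → ℝ) (k : Fin n) : |α k| ≤ chargeNorm α :=
  le_ciSup (f := fun k => |α k|) (Set.finite_range _).bddAbove k

theorem chargeNorm_lt {n : ℕ} [NeZero n] {α : Fin n → ℝ} {c : ℝ} (h : ∀ k, |α k| < c) :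
    chargeNorm α < c := by
  obtain ⟨k, hk⟩ := exists_eq_ciSup_of_finite (f := fun k => |α k|)
  exact hk.symm.trans_lt (h k)

theorem integrable_onePointIntegrand_of_lipNorm_le {Ω S : Set ℂ} (ho : IsOpen Ω)
    (hb : Bornology.IsBounded Ω) {κ : ℝ} (hκ : 0 ≤ κ) (hκ1 : κ < Real.sqrt (4 * Real.pi))
    (hS : IsCompact S) (hSΩ : S ⊆ Ω) {M : ENNReal} (hM : M ≠ ⊤) {m : ℕ} {α : Fin (m + 1) → ℝ}
    {f : Fin m → ℂ → ℂ} (hα : ∀ k, |α k| ≤ κ) (hfS : ∀ j, Function.support (f j) ⊆ S)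
    (hfM : ∀ j, lipNorm Ω (f j) ≤ M) {x : ℂ} (hx : x ∈ Ω) :
    Integrable (onePointIntegrand Ω α f x) := by
  obtain ⟨C, -, hC⟩ := exists_onePointIntegral_bounds ho hb (hS.insert x)
    (Set.insert_subset hx hSΩ) hκ hκ1 M.toReal_nonneg
  exact (hC m α f hα (fun j => isLipschitzTestFunction_of_lipNorm_le hM
    ((hfS j).trans (Set.subset_insert x S)) (hfM j)) _ rfl x (Set.mem_insert x S)).1

/-- `C` is an admissible constant in the Lipschitz bound `‖G_n‖_{Lip(K)} ≤ Cⁿ n^{(κ²/8π) n}` for all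
`n = m + 1`, all charges at most `κ` in absolute value and all functions `f_j` supported in `S` with
Lipschitz norm at most `M`. -/
def IsOnePointLipConstant (Ω K : Set ℂ) (κ : ℝ) (S : Set ℂ) (M : ENNReal) (C : ℝ) : Prop :=
  ∀ (m : ℕ) (α : Fin (m + 1) → ℝ) (f : Fin m → ℂ → ℂ),
    (∀ k, |α k| ≤ κ) → (∀ j, Function.support (f j) ⊆ S) → (∀ j, lipNorm Ω (f j) ≤ M) →
    (∃ L : NNReal, LipschitzOnWith L (onePointIntegral Ω α f) K) ∧
    lipNorm K (onePointIntegral Ω α f) ≤ ENNReal.ofReal (C ^ (m + 1) *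
      ((m + 1 : ℕ) : ℝ) ^ (κ ^ 2 / (8 * Real.pi) * ((m + 1 : ℕ) : ℝ)))

theorem exists_isOnePointLipConstant {Ω K S : Set ℂ} (ho : IsOpen Ω)
    (hb : Bornology.IsBounded Ω) (hK : IsCompact K) (hKΩ : K ⊆ Ω) {κ : ℝ} (hκ : 0 ≤ κ)
    (hκ1 : κ < Real.sqrt (4 * Real.pi)) (hS : IsCompact S) (hSΩ : S ⊆ Ω) {M : ENNReal}
    (hM : M ≠ ⊤) :
    ∃ C : ℝ, 0 < C ∧ IsOnePointLipConstant Ω K κ S M C := by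
  obtain ⟨C, hC0, hC⟩ := exists_onePointIntegral_bounds ho hb (hK.union hS)
    (Set.union_subset hKΩ hSΩ) hκ hκ1 M.toReal_nonneg
  refine ⟨2 * C, by positivity, fun m α f hα hfS hfM => ?_⟩
  set P := (C * ((m + 1 : ℕ) : ℝ) ^ (κ ^ 2 / (8 * Real.pi))) ^ (m + 1) with hP
  have hP0 : 0 ≤ P := by positivity
  have hbound := hC m α f hα (fun j => isLipschitzTestFunction_of_lipNorm_le hM
    ((hfS j).trans Set.subset_union_right) (hfM j)) P rfl
  have hsub : ∀ x ∈ K, ∀ y ∈ K,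
      ‖onePointIntegral Ω α f x - onePointIntegral Ω α f y‖ ≤ P * ‖x - y‖ :=
    fun x hx y hy => (hbound y (.inl hy)).2.2 x (.inl hx)
  refine ⟨⟨P.toNNReal, LipschitzOnWith.of_dist_le_mul fun x hx y hy => ?_⟩,
    (lipNorm_le_ofReal_two_mul hP0 (fun x hx => (hbound x (.inl hx)).2.1) hsub).trans ?_⟩
  · rw [dist_eq_norm, dist_eq_norm, Real.coe_toNNReal _ hP0]
    exact hsub x hx y hy
  · refine ENNReal.ofReal_le_ofReal ?_
    rw [hP, mul_pow, ← Real.rpow_mul_natCast (by positivity), mul_pow, mul_assoc]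
    gcongr
    exact le_self_pow₀ one_le_two m.succ_ne_zero

theorem proposition3p6_general {Ω K : Set ℂ} (ho : IsOpen Ω) (hb : Bornology.IsBounded Ω)
    (hK : IsCompact K) (hKΩ : K ⊆ Ω) :
    ∃ C : ℝ → Set ℂ → ENNReal → ℝ, (∀ a S M, 0 < C a S M) ∧
      ∀ (m : ℕ) (α : Fin (m + 1) → ℝ) (f : Fin m → ℂ → ℂ),
        (∀ i, |α i| < Real.sqrt (4 * Real.pi)) →
        (∀ j, lipNorm Ω (f j) ≠ ⊤ ∧ HasCompactSupport (f j) ∧ tsupport (f j) ⊆ Ω) →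
        (∀ x₁ ∈ Ω, IntegrableOn (onePointIntegrand Ω α f x₁)
          (Set.univ.pi fun _ : Fin m => Ω)) ∧
        (∃ L : NNReal, LipschitzOnWith L (onePointIntegral Ω α f) K) ∧
        lipNorm K (onePointIntegral Ω α f) ≤ ENNReal.ofReal
          (C (chargeNorm α) (⋃ j, tsupport (f j)) (⨆ j, lipNorm Ω (f j)) ^ (m + 1) *
            ((m + 1 : ℕ) : ℝ) ^ (chargeNorm α ^ 2 / (8 * Real.pi) * ((m + 1 : ℕ) : ℝ))) := by
  have hconst : ∀ κ S M, ∃ C : ℝ, 0 < C ∧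
      ((∃ C' > 0, IsOnePointLipConstant Ω K κ S M C') → IsOnePointLipConstant Ω K κ S M C) :=
    fun κ S M => by
      by_cases h : ∃ C' > 0, IsOnePointLipConstant Ω K κ S M C'
      · exact h.imp fun C hC => ⟨hC.1, fun _ => hC.2⟩
      · exact ⟨1, one_pos, fun h' => (h h').elim⟩
  choose C hC0 hC using hconst
  refine ⟨C, hC0, fun m α f hα hf => ?_⟩
  have hκ := chargeNorm_nonneg α
  have hκ1 := chargeNorm_lt hα
  have hS : IsCompact (⋃ j, tsupport (f j)) := isCompact_iUnion fun j => (hf j).2.1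
  have hSΩ : ⋃ j, tsupport (f j) ⊆ Ω := Set.iUnion_subset fun j => (hf j).2.2
  have hM : ⨆ j, lipNorm Ω (f j) ≠ ⊤ := iSup_ne_top fun j => (hf j).1
  have hfS : ∀ j, Function.support (f j) ⊆ ⋃ j, tsupport (f j) := fun j =>
    (subset_tsupport _).trans (Set.subset_iUnion (fun j => tsupport (f j)) j)
  have hfM : ∀ j, lipNorm Ω (f j) ≤ ⨆ j, lipNorm Ω (f j) := le_iSup _
  exact ⟨fun x hx => (integrable_onePointIntegrand_of_lipNorm_le ho hb hκ hκ1 hS hSΩ hM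
      (abs_le_chargeNorm α) hfS hfM hx).integrableOn,
    hC _ _ _ (exists_isOnePointLipConstant ho hb hK hKΩ hκ hκ1 hS hSΩ hM) m α f
      (abs_le_chargeNorm α) hfS hfM⟩

/-- Here `n = m + 1 ≥ 2`, and the constant is a function of `‖α‖`, of the union of the supports
of the `f_i` and of the maximum of their Lipschitz norms, chosen for given `Ω` and `K`. -/
theorem proposition3p6 (Ω : Set ℂ) (hΩ : IsSmoothBoundedOpen Ω)
    (K : Set ℂ) (hK : IsCompact K) (hKΩ : K ⊆ Ω) :
    ∃ C : ℝ → Set ℂ → ENNReal → ℝ, (∀ a S M, 0 < C a S M) ∧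
      ∀ (m : ℕ), 1 ≤ m → ∀ (α : Fin (m + 1) → ℝ) (f : Fin m → ℂ → ℂ),
        (∀ i, |α i| < Real.sqrt (4 * Real.pi)) →
        (∀ j, ContDiff ℝ ∞ (f j) ∧ HasCompactSupport (f j) ∧ tsupport (f j) ⊆ Ω) →
        (∀ x₁ ∈ Ω, IntegrableOn (onePointIntegrand Ω α f x₁)
          (Set.univ.pi fun _ : Fin m => Ω)) ∧
        (∃ L : NNReal, LipschitzOnWith L (onePointIntegral Ω α f) K) ∧
        lipNorm K (onePointIntegral Ω α f) ≤ ENNReal.ofReal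
          (C (chargeNorm α) (⋃ j, tsupport (f j)) (⨆ j, lipNorm Ω (f j)) ^ (m + 1) *
            ((m + 1 : ℕ) : ℝ) ^ (chargeNorm α ^ 2 / (8 * Real.pi) * ((m + 1 : ℕ) : ℝ))) := by
  obtain ⟨C, hC0, hC⟩ := proposition3p6_general hΩ.isOpen hΩ.isBounded hK hKΩ
  exact ⟨C, hC0, fun m _ α f hα hf => hC m α f hα fun j =>
    ⟨lipNorm_ne_top_of_hasCompactSupport ((hf j).1.of_le (by simp)) (hf j).2.1, (hf j).2⟩⟩
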